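/- **Setting.** Let $(\Omega,\mathcal F,P)$ be a probability space and $\mathbb K\in\{\mathbb R,\mathbb C\}$. Let $L^0(\mathcal F,\mathbb K)$ be the algebra of a.s.-equality classes of $\mathbb K$-valued random variables, $L^0(\mathcal F)=L^0(\mathcal F,\mathbb R)$ with its a.s. order, $L^0_+(\mathcal F)=\{\xi\in L^0(\mathcal F):\xi\ge 0\}$; $\bigvee,\bigwedge$ denote suprema and infima in the Dedekind complete lattice $L^0(\mathcal F)$. $\tilde I_A$ is the class of the indicator of $A\in\mathcal F$. $\Pi_{\mathcal F}$ is the set of sequences $(A_n)$ of pairwise disjoint sets in $\mathcal F$ with union $\Omega$. $B_{\mathcal F}$ is the measure algebra ($\mathcal F$ modulo null sets), $[A]$ the class of $A$, $1=[\Omega]$. A *random normed module* over $\mathbb K$ with base $(\Omega,\mathcal F,P)$ is an $L^0(\mathcal F,\mathbb K)$-module $E$ with a map $\|\cdot\|:E\to L^0_+(\mathcal F)$ such that $\|\xi x\|=|\xi|\,\|x\|$, $\|x+y\|\le\|x\|+\|y\|$, and $\|x\|=0$ implies $x=0$. Its $(\varepsilon,\lambda)$-topology is the linear topology with the sets $\{x: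 P(\|x\|<\varepsilon)>1-\lambda\}$, $\varepsilon>0$, $0<\lambda<1$, as a base of neighbourhoods of $0$. "Closed", "complete" and closures $[\cdot]^-$ refer to it. A nonempty $S\subseteq E$ is *$L^0$-convex* if $\xi x+(1-\xi)y\in S$ for all $x,y\in S$ and $\xi\in L^0(\mathcal F)$ with $0\le\xi\le1$; it is *$\sigma$-stable* if for all sequences $(x_n)$ in $S$ and $(A_n)\in\Pi_{\mathcal F}$ there is $x\in S$ with $\tilde I_{A_n}x=\tilde I_{A_n}x_n$ for all $n$ (such an $x$ is unique; write $x=\sum_n\tilde I_{A_n}x_n$). For sets $G_n$, $\sum_n\tilde I_{A_n}G_n=\{\sum_n\tilde I_{A_n}x_n:x_n\in G_n\}$. $S$ is *a.s. bounded* if $\{\|x\|:x\in S\}$ is bounded above in $L^0(\mathcal F)$. A nonempty closed $L^0$-convex set $G$ is *$L^0$-convexly compact* if every family of closed $L^0$-convex subsets of $G$ with the finite intersection property has nonempty intersection. For a nonempty a.s. bounded $H$ and a nonempty $G$ put $R(H,x)=\bigvee_{y\in H}\|x-y\|$, $R(H,G)=\bigwedge_{x\in G}R(H,x)$, $C(H,G)=\{x\in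 G:R(H,x)=R(H,G)\}$, $D(H)=\bigvee_{x,y\in H}\|x-y\|$. *Random normal structure.* A nonempty closed $L^0$-convex set $G$ has random normal structure if for every a.s. bounded closed $L^0$-convex $H\subseteq G$ with $D(H)>0$ (that is, $D(H)\geq 0$ and $D(H)\ne0$) there is $z\in H$ with $R(H,z)<D(H)$ a.s. on $(D(H)>0)$. *Consistent nets.* An equivalence relation on $\Lambda\times B_{\mathcal F}$, the class of $(\alpha,a)$ being written $\alpha|a$, is *regular* if (1) $\alpha|a=\beta|b$ implies $a=b$; (2) $\alpha|a=\beta|a$ implies $\alpha|b=\beta|b$ for all $b\le a$; (3) $\{a:\alpha|a=\beta|a\}$ has a greatest element for all $\alpha,\beta$; (4) $\alpha|1=\beta|1$ implies $\alpha=\beta$. A nonempty $\Lambda$ with such a relation is *$B_{\mathcal F}$-stable* if for all sequences $(\alpha_n)$ in $\Lambda$ and $(A_n)\in\Pi_{\mathcal F}$ there is a (necessarily unique) $\alpha=\sum_n\alpha_n|[A_n]\in\Lambda$ with $\alpha|[A_n]=\alpha_n|[A_n]$ for all $n$. A *decreasing consistent net* of $\sigma$-stable subsets of $W$ is a family $\{W_\alpha,\alpha\in\Lambda\}$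 of $\sigma$-stable (in particular nonempty) subsets of $W$ indexed by a $B_{\mathcal F}$-stable directed set $\Lambda$, with $W_\alpha\subseteq W_\beta$ whenever $\alpha\ge\beta$ and $W_{\sum_n\alpha_n|[A_n]}=\sum_n\tilde I_{A_n}W_{\alpha_n}$ for all $(\alpha_n)$ in $\Lambda$ and $(A_n)\in\Pi_{\mathcal F}$. *Random complete normal structure.* An a.s. bounded closed $L^0$-convex set $G$ has random complete normal structure if for every closed $L^0$-convex $W\subseteq G$ with more than one point and every decreasing consistent net $\{W_\alpha,\alpha\in\Lambda\}$ of $\sigma$-stable subsets of $W$ with $R(W_\alpha,W)=R(W,W)$ for all $\alpha$, the set $K=[\bigcup_{\alpha}C(W_\alpha,W)]^-$ is nonempty and for every $B\in\mathcal F$ with $B\subseteq(D(W)>0)$ and $P(B)>0$ there is $y_B\in W$ with $\tilde I_By_B\notin\tilde I_BK$. (A set that is not a.s. bounded does not have random complete normal structure.) **Theorem.** Let $E$ be a random normed module over $\mathbb K$ with base $(\Omega,\mathcal F,P)$ that is complete in the $(\varepsilon,\lambda)$-topology, and let $G\subseteq E$ be $L^0$-convexly compact. Then $G$ has random complete normal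 structure if and only if $G$ has random normal structure. -/

import Mathlib

open MeasureTheory Set Filter Topology

universe v

noncomputable section

namespace RandomNormed

variable {Ω : Type*} [MeasurableSpace Ω]

/-! ### The algebra `L⁰(ℱ, 𝕂)`

`Ω →ₘ[P] 𝕜` is Mathlib's type of a.e.-equality classes of `𝕜`-valued random variables, with
pointwise operations and the a.e. order. Mathlib supplies its additive group, its multiplicative
monoid and its order; here they are put together into a commutative ring. -/

instance instCommRingL0 {P : Measure Ω} {R : Type*} [CommRing R] [TopologicalSpace R]
    [IsTopologicalRing R] : CommRing (Ω →ₘ[P] R) where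
  __ := (inferInstance : AddCommGroup (Ω →ₘ[P] R))
  __ := (inferInstance : CommMonoid (Ω →ₘ[P] R))
  left_distrib f g h := by
    refine AEEqFun.ext ?_
    filter_upwards [AEEqFun.coeFn_mul f (g + h), AEEqFun.coeFn_add g h,
      AEEqFun.coeFn_add (f * g) (f * h), AEEqFun.coeFn_mul f g, AEEqFun.coeFn_mul f h]
      with ω h1 h2 h3 h4 h5
    change (f * (g + h)) ω = (f * g + f * h) ω
    rw [h1, h3]
    simp only [Pi.mul_apply, Pi.add_apply, h2, h4, h5, mul_add]
  right_distrib f g h := by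
    refine AEEqFun.ext ?_
    filter_upwards [AEEqFun.coeFn_mul (f + g) h, AEEqFun.coeFn_add f g,
      AEEqFun.coeFn_add (f * h) (g * h), AEEqFun.coeFn_mul f h, AEEqFun.coeFn_mul g h]
      with ω h1 h2 h3 h4 h5
    change ((f + g) * h) ω = (f * h + g * h) ω
    rw [h1, h3]
    simp only [Pi.mul_apply, Pi.add_apply, h2, h4, h5, add_mul]
  zero_mul f := by
    refine AEEqFun.ext ?_
    filter_upwards [AEEqFun.coeFn_mul 0 f, AEEqFun.coeFn_zero (μ := P) (β := R)] with ω h1 h2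
    change (0 * f) ω = (0 : Ω →ₘ[P] R) ω
    rw [h1, Pi.mul_apply, h2, Pi.zero_apply, zero_mul]
  mul_zero f := by
    refine AEEqFun.ext ?_
    filter_upwards [AEEqFun.coeFn_mul f 0, AEEqFun.coeFn_zero (μ := P) (β := R)] with ω h1 h2
    change (f * 0) ω = (0 : Ω →ₘ[P] R) ω
    rw [h1, Pi.mul_apply, h2, Pi.zero_apply, mul_zero]

/-- The modulus `|ξ| ∈ L⁰(ℱ)` of `ξ ∈ L⁰(ℱ, 𝕂)`. -/
def modulus {P : Measure Ω} {𝕜 : Type*} [RCLike 𝕜] (ξ : Ω →ₘ[P] 𝕜) : Ω →ₘ[P] ℝ :=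
  AEEqFun.comp (fun z : 𝕜 => ‖z‖) continuous_norm ξ

/-- The inclusion `L⁰(ℱ) → L⁰(ℱ, 𝕂)`. -/
def ofRealL0 {P : Measure Ω} (𝕜 : Type*) [RCLike 𝕜] (ξ : Ω →ₘ[P] ℝ) : Ω →ₘ[P] 𝕜 :=
  AEEqFun.comp (fun t : ℝ => (t : 𝕜)) RCLike.continuous_ofReal ξ

/-- The equivalence class of the characteristic function of the measurable set `A`. -/
def ind (P : Measure Ω) (𝕜 : Type*) [RCLike 𝕜] {A : Set Ω} (hA : MeasurableSet A) : Ω →ₘ[P] 𝕜 :=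
  AEEqFun.mk (A.indicator fun _ => (1 : 𝕜)) (aestronglyMeasurable_const.indicator hA)

/-- The supremum in `L⁰(ℱ)`: for a nonempty set that is bounded above it is the least upper bound,
which exists because `L⁰(ℱ)` is Dedekind complete. -/
def supL0 {P : Measure Ω} (S : Set (Ω →ₘ[P] ℝ)) : Ω →ₘ[P] ℝ :=
  open Classical in if h : ∃ r, IsLUB S r then h.choose else 0

/-- The infimum in `L⁰(ℱ)`: for a nonempty set that is bounded below it is the greatest lower
bound. -/
def infL0 {P : Measure Ω} (S : Set (Ω →ₘ[P] ℝ)) : Ω →ₘ[P] ℝ :=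
  open Classical in if h : ∃ r, IsGLB S r then h.choose else 0

theorem supL0_eq {P : Measure Ω} {S : Set (Ω →ₘ[P] ℝ)} {r : Ω →ₘ[P] ℝ} (h : IsLUB S r) :
    supL0 S = r := by
  have h' : ∃ r, IsLUB S r := ⟨r, h⟩
  rw [supL0, dif_pos h']
  exact h'.choose_spec.unique h

theorem infL0_eq {P : Measure Ω} {S : Set (Ω →ₘ[P] ℝ)} {r : Ω →ₘ[P] ℝ} (h : IsGLB S r) :
    infL0 S = r := by
  have h' : ∃ r, IsGLB S r := ⟨r, h⟩
  rw [infL0, dif_pos h']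
  exact h'.choose_spec.unique h

/-! ### The measure algebra and countable partitions -/

/-- A countable partition of `Ω` to `ℱ`; some of its members may be empty. -/
structure CountablePartition (Ω : Type*) [MeasurableSpace Ω] where
  set : ℕ → Set Ω
  measurable : ∀ n, MeasurableSet (set n)
  disjoint : Pairwise (Function.onFun Disjoint set)
  iUnion_eq : ⋃ n, set n = univ

/-- Two measurable sets are equivalent if their symmetric difference is null. -/
def nullSetoid (P : Measure Ω) : Setoid {A : Set Ω // MeasurableSet A} where
  r A B := (A : Set Ω) =ᵐ[P] (B : Set Ω)
  iseqv := ⟨fun _ => ae_eq_refl _, fun h => h.symm, fun h₁ h₂ => h₁.trans h₂⟩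

/-- The measure algebra `B_ℱ` of `(Ω, ℱ, P)`. -/
def MeasureAlgebra (P : Measure Ω) : Type _ := Quotient (nullSetoid P)

/-- The class `[A]` of a measurable set. -/
def MeasureAlgebra.mk (P : Measure Ω) {A : Set Ω} (hA : MeasurableSet A) : MeasureAlgebra P :=
  Quotient.mk (nullSetoid P) ⟨A, hA⟩

instance (P : Measure Ω) : PartialOrder (MeasureAlgebra P) where
  le := Quotient.lift₂ (fun A B => (A : Set Ω) ≤ᵐ[P] (B : Set Ω)) (by
    intro A B A' B' hA hB
    exact propext ⟨fun h => hA.symm.le.trans (h.trans hB.le),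
      fun h => hA.le.trans (h.trans hB.symm.le)⟩)
  le_refl a := Quotient.inductionOn a fun _ => Filter.EventuallyLE.refl _ _
  le_trans a b c := Quotient.inductionOn₃ a b c fun _ _ _ h₁ h₂ => Filter.EventuallyLE.trans h₁ h₂
  le_antisymm a b := Quotient.inductionOn₂ a b fun _ _ h₁ h₂ =>
    Quotient.sound (Filter.EventuallyLE.antisymm h₁ h₂)

/-- An equivalence relation on `X × B_ℱ` is regular. The class of `(x, a)` is written `x|a` in the
informal mathematics, so `r (x, a) (y, b)` says `x|a = y|b`. -/
structure IsRegularRel {P : Measure Ω} {X : Type*} (r : Setoid (X × MeasureAlgebra P)) :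
    Prop where
  snd_eq : ∀ x y a b, r.r (x, a) (y, b) → a = b
  mono : ∀ x y a b, b ≤ a → r.r (x, a) (y, a) → r.r (x, b) (y, b)
  exists_greatest : ∀ x y, ∃ g, IsGreatest {a | r.r (x, a) (y, a)} g
  eq_of_one : ∀ x y, r.r (x, MeasureAlgebra.mk P MeasurableSet.univ)
    (y, MeasureAlgebra.mk P MeasurableSet.univ) → x = y

/-- `z = ∑ₙ xₙ|aₙ`, that is `z|aₙ = xₙ|aₙ` for all `n`, where `aₙ = [Aₙ]`. -/
def IsGluing {P : Measure Ω} {X : Type*} (r : Setoid (X × MeasureAlgebra P))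
    (A : CountablePartition Ω) (x : ℕ → X) (z : X) : Prop :=
  ∀ n, r.r (z, MeasureAlgebra.mk P (A.measurable n)) (x n, MeasureAlgebra.mk P (A.measurable n))

/-- `X` is a `B_ℱ`-stable set with respect to the regular relation `r`. The sequences that are
partitions of unity in `B_ℱ` are exactly the sequences `([Aₙ])` with `(Aₙ)` a countable
partition of `Ω` to `ℱ`. -/
structure IsStableIndex {P : Measure Ω} {X : Type*} (r : Setoid (X × MeasureAlgebra P)) :
    Prop where
  nonempty : Nonempty X
  regular : IsRegularRel r
  exists_gluing : ∀ (A : CountablePartition Ω) (x : ℕ → X), ∃ z, IsGluing r A x z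

/-! ### Random normed modules and the `(ε, λ)`-topology -/

/-- An `L⁰`-norm on the `L⁰(ℱ, 𝕂)`-module `E`; `E` with such a norm is a random normed module over
`𝕂` with base `(Ω, ℱ, P)`. -/
structure L0Norm (P : Measure Ω) (𝕜 : Type*) [RCLike 𝕜] (E : Type*) [AddCommGroup E]
    [Module (Ω →ₘ[P] 𝕜) E] where
  toFun : E → (Ω →ₘ[P] ℝ)
  nonneg : ∀ x, 0 ≤ toFun x
  map_smul : ∀ (ξ : Ω →ₘ[P] 𝕜) (x : E), toFun (ξ • x) = modulus ξ * toFun x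
  triangle : ∀ x y, toFun (x + y) ≤ toFun x + toFun y
  eq_zero : ∀ x, toFun x = 0 → x = 0

section Module

variable {P : Measure Ω} {𝕜 : Type*} [RCLike 𝕜] {E : Type*} [AddCommGroup E]
  [Module (Ω →ₘ[P] 𝕜) E]

instance : CoeFun (L0Norm P 𝕜 E) fun _ => E → (Ω →ₘ[P] ℝ) := ⟨L0Norm.toFun⟩

theorem L0Norm.map_zero (N : L0Norm P 𝕜 E) : N 0 = 0 := by
  have h := N.map_smul 0 0
  have h0 : modulus (0 : Ω →ₘ[P] 𝕜) = 0 := by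
    refine AEEqFun.ext ?_
    filter_upwards [AEEqFun.coeFn_comp (fun z : 𝕜 => ‖z‖) continuous_norm (0 : Ω →ₘ[P] 𝕜),
      AEEqFun.coeFn_zero (μ := P) (β := 𝕜), AEEqFun.coeFn_zero (μ := P) (β := ℝ)] with ω h1 h2 h3
    rw [modulus, h1, h3, Function.comp_apply, h2]
    simp
  rw [h0, zero_mul, smul_zero] at h
  exact h

theorem L0Norm.map_neg (N : L0Norm P 𝕜 E) (x : E) : N (-x) = N x := by
  have h := N.map_smul (-1) x
  have h1 : modulus (-1 : Ω →ₘ[P] 𝕜) = 1 := by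
    refine AEEqFun.ext ?_
    filter_upwards [AEEqFun.coeFn_comp (fun z : 𝕜 => ‖z‖) continuous_norm (-1 : Ω →ₘ[P] 𝕜),
      AEEqFun.coeFn_neg (1 : Ω →ₘ[P] 𝕜), AEEqFun.coeFn_one (μ := P) (β := 𝕜),
      AEEqFun.coeFn_one (μ := P) (β := ℝ)] with ω h1 h2 h3 h4
    rw [modulus, h1, h4, Function.comp_apply]
    change ‖(-1 : Ω →ₘ[P] 𝕜) ω‖ = 1
    rw [h2, Pi.neg_apply, h3]
    simp
  rw [h1, one_mul, neg_smul, one_smul] at h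
  exact h

/-- `x - y ∈ N_θ(ε, δ)`, where `N_θ(ε, δ) = {z | P {‖z‖ < ε} > 1 - δ}`. -/
def L0Norm.entourage (N : L0Norm P 𝕜 E) (ε δ : ℝ) : Set (E × E) :=
  {p | 1 - δ < P.real {ω | N (p.1 - p.2) ω < ε}}

theorem L0Norm.entourage_mono [IsProbabilityMeasure P] (N : L0Norm P 𝕜 E) {ε ε' δ δ' : ℝ}
    (hε : ε ≤ ε') (hδ : δ ≤ δ') : N.entourage ε δ ⊆ N.entourage ε' δ' := by
  intro p (hp : 1 - δ < P.real {ω | N (p.1 - p.2) ω < ε})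
  have hsub : {ω | N (p.1 - p.2) ω < ε} ⊆ {ω | N (p.1 - p.2) ω < ε'} :=
    fun ω (h : N (p.1 - p.2) ω < ε) => lt_of_lt_of_le h hε
  have m : P.real {ω | N (p.1 - p.2) ω < ε} ≤ P.real {ω | N (p.1 - p.2) ω < ε'} :=
    measureReal_mono hsub
  change 1 - δ' < P.real {ω | N (p.1 - p.2) ω < ε'}
  linarith

theorem L0Norm.refl_mem_entourage [IsProbabilityMeasure P] (N : L0Norm P 𝕜 E) {ε δ : ℝ}
    (hε : 0 < ε) (hδ : 0 < δ) (x : E) : (x, x) ∈ N.entourage ε δ := by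
  change 1 - δ < P.real {ω | N (x - x) ω < ε}
  have h1 : P.real {ω | N (x - x) ω < ε} = 1 := by
    have h : {ω | N (x - x) ω < ε} =ᵐ[P] univ := by
      rw [eventuallyEq_univ, sub_self, N.map_zero]
      filter_upwards [AEEqFun.coeFn_zero (μ := P) (β := ℝ)] with ω hω
      rw [hω]
      exact hε
    rw [measureReal_congr h, probReal_univ]
  linarith

theorem L0Norm.swap_mem_entourage (N : L0Norm P 𝕜 E) {ε δ : ℝ} {x y : E}
    (h : (x, y) ∈ N.entourage ε δ) : (y, x) ∈ N.entourage ε δ := by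
  change 1 - δ < P.real {ω | N (y - x) ω < ε}
  rw [show y - x = -(x - y) from (neg_sub x y).symm, N.map_neg]
  exact h

theorem L0Norm.comp_mem_entourage [IsProbabilityMeasure P] (N : L0Norm P 𝕜 E) {ε δ : ℝ}
    {x y z : E} (h₁ : (x, y) ∈ N.entourage (ε / 2) (δ / 2))
    (h₂ : (y, z) ∈ N.entourage (ε / 2) (δ / 2)) : (x, z) ∈ N.entourage ε δ := by
  change 1 - δ < P.real {ω | N (x - z) ω < ε}
  change 1 - δ / 2 < P.real {ω | N (x - y) ω < ε / 2} at h₁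
  change 1 - δ / 2 < P.real {ω | N (y - z) ω < ε / 2} at h₂
  have hm : MeasurableSet {ω | N (y - z) ω < ε / 2} :=
    measurableSet_lt (N (y - z)).measurable measurable_const
  have hu := measureReal_union_add_inter (μ := P) (s := {ω | N (x - y) ω < ε / 2}) hm
  have hle : P.real ({ω | N (x - y) ω < ε / 2} ∪ {ω | N (y - z) ω < ε / 2}) ≤ 1 :=
    measureReal_le_one
  have hi : P.real ({ω | N (x - y) ω < ε / 2} ∩ {ω | N (y - z) ω < ε / 2}) ≤
      P.real {ω | N (x - z) ω < ε} := by
    refine ENNReal.toReal_mono (measure_ne_top _ _) (measure_mono_ae ?_)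
    have ht := N.triangle (x - y) (y - z)
    rw [sub_add_sub_cancel] at ht
    filter_upwards [AEEqFun.coeFn_le.2 ht, AEEqFun.coeFn_add (N (x - y)) (N (y - z))]
      with ω h3 h4 h5
    have h6 : N (x - y) ω < ε / 2 := h5.1
    have h7 : N (y - z) ω < ε / 2 := h5.2
    rw [h4, Pi.add_apply] at h3
    change N (x - z) ω < ε
    linarith
  linarith

/-- The `(ε, λ)`-uniformity: the translation invariant uniform structure for which the sets
`N_θ(ε, δ)`, `ε > 0`, `0 < δ < 1`, are a base of neighbourhoods of the null element. -/
@[reducible] def L0Norm.uniformSpace [IsProbabilityMeasure P] (N : L0Norm P 𝕜 E) : UniformSpace E :=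
  UniformSpace.ofCore <| UniformSpace.Core.mkOfBasis
    { sets := {V | ∃ ε δ : ℝ, 0 < ε ∧ 0 < δ ∧ δ < 1 ∧ V = N.entourage ε δ}
      nonempty := ⟨_, 1, 1 / 2, by norm_num, by norm_num, by norm_num, rfl⟩
      inter_sets := by
        rintro _ _ ⟨ε₁, δ₁, h₁, h₁', h₁'', rfl⟩ ⟨ε₂, δ₂, h₂, h₂', h₂'', rfl⟩
        exact ⟨_, ⟨min ε₁ ε₂, min δ₁ δ₂, lt_min h₁ h₂, lt_min h₁' h₂',
          (min_le_left _ _).trans_lt h₁'', rfl⟩, subset_inter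
            (N.entourage_mono (min_le_left _ _) (min_le_left _ _))
            (N.entourage_mono (min_le_right _ _) (min_le_right _ _))⟩ }
    (by
      rintro _ ⟨ε, δ, h, h', h'', rfl⟩ x
      exact N.refl_mem_entourage h h' x)
    (by
      rintro _ ⟨ε, δ, h, h', h'', rfl⟩
      exact ⟨_, ⟨ε, δ, h, h', h'', rfl⟩, fun p hp => N.swap_mem_entourage hp⟩)
    (by
      rintro _ ⟨ε, δ, h, h', h'', rfl⟩
      refine ⟨_, ⟨ε / 2, δ / 2, by linarith, by linarith, by linarith, rfl⟩, ?_⟩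
      rintro ⟨x, z⟩ ⟨y, hxy, hyz⟩
      exact N.comp_mem_entourage hxy hyz)

/-- `E` is complete in the `(ε, λ)`-topology. -/
def L0Norm.IsComplete [IsProbabilityMeasure P] (N : L0Norm P 𝕜 E) : Prop :=
  @CompleteSpace E N.uniformSpace

/-- `S` is closed in the `(ε, λ)`-topology. -/
def L0Norm.Closed [IsProbabilityMeasure P] (N : L0Norm P 𝕜 E) (S : Set E) : Prop :=
  @IsClosed E N.uniformSpace.toTopologicalSpace S

/-- The closure of `S` in the `(ε, λ)`-topology. -/
def L0Norm.cl [IsProbabilityMeasure P] (N : L0Norm P 𝕜 E) (S : Set E) : Set E :=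
  @closure E N.uniformSpace.toTopologicalSpace S

/-! ### Stable sets, `L⁰`-convexity and `L⁰`-convex compactness -/

variable (P 𝕜) in
/-- `S` is `σ`-stable: it is nonempty and contains a countable concatenation of each of its
sequences along each countable partition. -/
def IsSigmaStable (S : Set E) : Prop :=
  S.Nonempty ∧ ∀ (A : CountablePartition Ω) (x : ℕ → E), (∀ n, x n ∈ S) →
    ∃ z ∈ S, ∀ n, ind P 𝕜 (A.measurable n) • z = ind P 𝕜 (A.measurable n) • x n

variable (P 𝕜) in
/-- The countable concatenation `∑ₙ I_{Aₙ} Gₙ` of a sequence of sets: the set of all countable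
concatenations `∑ₙ I_{Aₙ} xₙ` with `xₙ ∈ Gₙ`. -/
def concatSets (A : CountablePartition Ω) (G : ℕ → Set E) : Set E :=
  {z | ∃ x : ℕ → E, (∀ n, x n ∈ G n) ∧
    ∀ n, ind P 𝕜 (A.measurable n) • z = ind P 𝕜 (A.measurable n) • x n}

variable (P 𝕜) in
/-- `S` is (nonempty and) `L⁰`-convex. -/
def IsL0Convex (S : Set E) : Prop :=
  S.Nonempty ∧ ∀ x ∈ S, ∀ y ∈ S, ∀ ξ : Ω →ₘ[P] ℝ, 0 ≤ ξ → ξ ≤ 1 →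
    ofRealL0 𝕜 ξ • x + (1 - ofRealL0 𝕜 ξ) • y ∈ S

/-- `S` is almost surely bounded: `{‖x‖ : x ∈ S}` has an upper bound in `L⁰(ℱ)`, that is (for
nonempty `S`) its supremum among extended random variables is finite a.s. -/
def L0Norm.AsBounded (N : L0Norm P 𝕜 E) (S : Set E) : Prop := BddAbove (N.toFun '' S)

/-- `G` is `L⁰`-convexly compact. -/
structure L0Norm.IsL0ConvexlyCompact [IsProbabilityMeasure P] (N : L0Norm P 𝕜 E) (G : Set E) :
    Prop where
  closed : N.Closed G
  convex : IsL0Convex P 𝕜 G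
  inter_nonempty : ∀ 𝒞 : Set (Set E),
    (∀ C ∈ 𝒞, C ⊆ G ∧ N.Closed C ∧ IsL0Convex P 𝕜 C) →
    (∀ 𝒟 ⊆ 𝒞, 𝒟.Finite → (⋂₀ 𝒟).Nonempty) → (⋂₀ 𝒞).Nonempty

/-! ### Random Chebyshev radius and center, random diameter -/

/-- `R(H, x) = ⋁ {‖x - y‖ : y ∈ H}`. -/
def L0Norm.radAt (N : L0Norm P 𝕜 E) (H : Set E) (x : E) : Ω →ₘ[P] ℝ :=
  supL0 ((fun y => N (x - y)) '' H)

/-- The random Chebyshev radius `R(H, G) = ⋀ {R(H, x) : x ∈ G}`. -/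
def L0Norm.rad (N : L0Norm P 𝕜 E) (H G : Set E) : Ω →ₘ[P] ℝ :=
  infL0 (N.radAt H '' G)

/-- The random Chebyshev center `C(H, G) = {x ∈ G : R(H, x) = R(H, G)}`. -/
def L0Norm.center (N : L0Norm P 𝕜 E) (H G : Set E) : Set E :=
  {x ∈ G | N.radAt H x = N.rad H G}

/-- The random diameter `D(H) = ⋁ {‖x - y‖ : x, y ∈ H}`. -/
def L0Norm.diam (N : L0Norm P 𝕜 E) (H : Set E) : Ω →ₘ[P] ℝ :=
  supL0 (image2 (fun x y => N (x - y)) H H)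

/-! ### Random normal structure and random complete normal structure -/

/-- `G` has random normal structure. -/
structure L0Norm.HasRandomNormalStructure [IsProbabilityMeasure P] (N : L0Norm P 𝕜 E)
    (G : Set E) : Prop where
  closed : N.Closed G
  convex : IsL0Convex P 𝕜 G
  exists_nondiametral : ∀ H ⊆ G, N.AsBounded H → N.Closed H → IsL0Convex P 𝕜 H →
    0 < N.diam H → ∃ z ∈ H, ∀ᵐ ω ∂P, 0 < N.diam H ω → N.radAt H z ω < N.diam H ω

variable (P 𝕜) in
/-- `{F α, α ∈ Λ}` is a decreasing consistent net (with the `B_ℱ`-stable directed index set `Λ`,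
whose stability refers to the regular relation `r`) of `σ`-stable subsets of `W`. -/
structure IsDecreasingConsistentNet {Λ : Type v} [Preorder Λ] (r : Setoid (Λ × MeasureAlgebra P))
    (W : Set E) (F : Λ → Set E) : Prop where
  directed : IsDirectedOrder Λ
  stable_index : IsStableIndex r
  subset : ∀ α, F α ⊆ W
  sigmaStable : ∀ α, IsSigmaStable P 𝕜 (F α)
  consistent : ∀ (A : CountablePartition Ω) (α : ℕ → Λ) (β : Λ), IsGluing r A α β →
    F β = concatSets P 𝕜 A fun n => F (α n)
  decreasing : Antitone F

/-- `G` has random complete normal structure. The universe `v` is that of the index sets of the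
nets. -/
structure L0Norm.HasRandomCompleteNormalStructure [IsProbabilityMeasure P] (N : L0Norm P 𝕜 E)
    (G : Set E) : Prop where
  asBounded : N.AsBounded G
  closed : N.Closed G
  convex : IsL0Convex P 𝕜 G
  condition : ∀ W ⊆ G, N.Closed W → IsL0Convex P 𝕜 W → W.Nontrivial →
    ∀ (Λ : Type v) [Preorder Λ] (r : Setoid (Λ × MeasureAlgebra P)) (F : Λ → Set E),
      IsDecreasingConsistentNet P 𝕜 r W F → (∀ α, N.rad (F α) W = N.rad W W) →
        (N.cl (⋃ α, N.center (F α) W)).Nonempty ∧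
        ∀ (B : Set Ω) (hB : MeasurableSet B), (∀ᵐ ω ∂P, ω ∈ B → 0 < N.diam W ω) → 0 < P B →
          ∃ y ∈ W, ind P 𝕜 hB • y ∉
            (fun x => ind P 𝕜 hB • x) '' N.cl (⋃ α, N.center (F α) W)

end Module

end RandomNormed

end

/-! From complete to ordinary normal structure, the definition is tested on the constant net `H`,
for which K is the closure of C(H, H). If a center z had R(H, z) ≥ D(H) on an event B of positive
probability with D(H) > 0 on B, then splicing any y ∈ H into z on B would give another center. Every
point of `H` would agree on B with a point of K, which is excluded.

The converse is by contradiction. Put r = R(W, W) and suppose that on some event of positive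
probability every point of W agrees with a point of K. Points of K are limits of centers and R(W_α,
·) is 1-Lipschitz, so for each x ∈ W the infimum over α of R(W_α, x) is at most r there. Consistency
of the net glues indices, so a single α achieves r + ε
(`IsDecreasingConsistentNet.exists_radAt_le`). Compactness gives a point w common to all closed
L⁰-convex subsets of W that contain some W_α, and w lies within r of every point of W. Far along the
net, for finitely many points Z and any m in W, there is u within r + ε of Z and at distance at
least r - ε from m. Moving u slightly towards w removes the excess ε and yields a sequence with
mutual distances at most r, each term being almost r away from the mean of its predecessors
(`IsL0Convex.exists_nearly_diametral_seq`). As in the Brodskii–Milman argument, its closed hull H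
satisfies D(H) ≤ r ≤ R(H, z) on the event for all z ∈ H (`exists_diametral`), against random normal
structure.

Complete normal structure includes a.s. boundedness, which has to be derived from compactness
(`asBounded`). A nested-set argument shows that G is nearly symmetric up to scaling. Iterating this
expands each point of G in an alternating series with uniformly controlled terms, and the remainder
vanishes because G has no recession directions. This bounds G in probability, and σ-stability with
Borel–Cantelli makes the bound almost sure. -/

noncomputable section

namespace RandomNormed

variable {Ω : Type*} [MeasurableSpace Ω]

/-! ### Pointwise calculus in L⁰ and gluing along countable partitions -/

section Scalars

variable {P : Measure Ω} {𝕜 : Type*} [RCLike 𝕜]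

theorem coeFn_ofRealL0 (ξ : Ω →ₘ[P] ℝ) :
    ∀ᵐ ω ∂P, ofRealL0 𝕜 ξ ω = ((ξ ω : ℝ) : 𝕜) :=
  AEEqFun.coeFn_comp _ _ ξ

theorem coeFn_modulus (ξ : Ω →ₘ[P] 𝕜) : ∀ᵐ ω ∂P, modulus ξ ω = ‖ξ ω‖ :=
  AEEqFun.coeFn_comp _ _ ξ

theorem coeFn_addL0 {R : Type*} [CommRing R] [TopologicalSpace R] [IsTopologicalRing R]
    (f g : Ω →ₘ[P] R) : ∀ᵐ ω ∂P, (f + g) ω = f ω + g ω := AEEqFun.coeFn_add f g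

theorem coeFn_subL0 {R : Type*} [CommRing R] [TopologicalSpace R] [IsTopologicalRing R]
    (f g : Ω →ₘ[P] R) : ∀ᵐ ω ∂P, (f - g) ω = f ω - g ω := AEEqFun.coeFn_sub f g

theorem coeFn_mulL0 {R : Type*} [CommRing R] [TopologicalSpace R] [IsTopologicalRing R]
    (f g : Ω →ₘ[P] R) : ∀ᵐ ω ∂P, (f * g) ω = f ω * g ω := AEEqFun.coeFn_mul f g

theorem coeFn_zeroL0 {R : Type*} [CommRing R] [TopologicalSpace R] [IsTopologicalRing R] :
    ∀ᵐ ω ∂P, (0 : Ω →ₘ[P] R) ω = 0 := AEEqFun.coeFn_zero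

theorem coeFn_oneL0 {R : Type*} [CommRing R] [TopologicalSpace R] [IsTopologicalRing R] :
    ∀ᵐ ω ∂P, (1 : Ω →ₘ[P] R) ω = 1 := AEEqFun.coeFn_one

/-- `ofRealL0` as a ring homomorphism. -/
def ofRealHom (P : Measure Ω) (𝕜 : Type*) [RCLike 𝕜] : (Ω →ₘ[P] ℝ) →+* (Ω →ₘ[P] 𝕜) where
  toFun := ofRealL0 𝕜
  map_one' := by
    refine AEEqFun.ext ?_
    filter_upwards [coeFn_ofRealL0 (𝕜 := 𝕜) (1 : Ω →ₘ[P] ℝ), coeFn_oneL0 (P := P) (R := 𝕜),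
      coeFn_oneL0 (P := P) (R := ℝ)] with ω h1 h2 h3
    rw [h1, h2, h3]; simp
  map_zero' := by
    refine AEEqFun.ext ?_
    filter_upwards [coeFn_ofRealL0 (𝕜 := 𝕜) (0 : Ω →ₘ[P] ℝ), coeFn_zeroL0 (P := P) (R := 𝕜),
      coeFn_zeroL0 (P := P) (R := ℝ)] with ω h1 h2 h3
    rw [h1, h2, h3]; simp
  map_mul' f g := by
    refine AEEqFun.ext ?_
    filter_upwards [coeFn_ofRealL0 (𝕜 := 𝕜) (f * g), coeFn_mulL0 f g, coeFn_ofRealL0 (𝕜 := 𝕜) f,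
      coeFn_ofRealL0 (𝕜 := 𝕜) g, coeFn_mulL0 (ofRealL0 𝕜 f) (ofRealL0 𝕜 g)] with ω h1 h2 h3 h4 h5
    rw [h1, h5, h2, h3, h4]; simp
  map_add' f g := by
    refine AEEqFun.ext ?_
    filter_upwards [coeFn_ofRealL0 (𝕜 := 𝕜) (f + g), coeFn_addL0 f g, coeFn_ofRealL0 (𝕜 := 𝕜) f,
      coeFn_ofRealL0 (𝕜 := 𝕜) g, coeFn_addL0 (ofRealL0 𝕜 f) (ofRealL0 𝕜 g)] with ω h1 h2 h3 h4 h5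
    rw [h1, h5, h2, h3, h4]; simp

theorem ofRealHom_apply (ξ : Ω →ₘ[P] ℝ) : ofRealHom P 𝕜 ξ = ofRealL0 𝕜 ξ := rfl

/-- The constants as elements of `L⁰(ℱ)`. -/
def constHom (P : Measure Ω) : ℝ →+* (Ω →ₘ[P] ℝ) where
  toFun c := AEEqFun.const Ω c
  map_one' := rfl
  map_zero' := rfl
  map_mul' _ _ := rfl
  map_add' _ _ := rfl

theorem coeFn_constHom (c : ℝ) : ∀ᵐ ω ∂P, constHom P c ω = c :=
  AEEqFun.coeFn_const Ω c

theorem constHom_nonneg {c : ℝ} (hc : 0 ≤ c) : 0 ≤ constHom P c := by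
  rw [← AEEqFun.coeFn_le]
  filter_upwards [coeFn_constHom (P := P) c, coeFn_zeroL0 (P := P) (R := ℝ)] with ω h1 h2
  rw [h1, h2]; exact hc

theorem constHom_le_one {c : ℝ} (hc : c ≤ 1) : constHom P c ≤ 1 := by
  rw [← AEEqFun.coeFn_le]
  filter_upwards [coeFn_constHom (P := P) c, coeFn_oneL0 (P := P) (R := ℝ)] with ω h1 h2
  rw [h1, h2]; exact hc

open Classical in
theorem coeFn_ind {A : Set Ω} (hA : MeasurableSet A) :
    ∀ᵐ ω ∂P, ind P 𝕜 hA ω = if ω ∈ A then 1 else 0 := by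
  filter_upwards [AEEqFun.coeFn_mk (μ := P) (A.indicator fun _ => (1 : 𝕜))
    (aestronglyMeasurable_const.indicator hA)] with ω h
  rw [ind, h, indicator_apply]

theorem ofRealL0_ind {A : Set Ω} (hA : MeasurableSet A) :
    ofRealL0 𝕜 (ind P ℝ hA) = ind P 𝕜 hA := by
  refine AEEqFun.ext ?_
  filter_upwards [coeFn_ofRealL0 (𝕜 := 𝕜) (ind P ℝ hA), coeFn_ind (P := P) (𝕜 := 𝕜) hA,
    coeFn_ind (P := P) (𝕜 := ℝ) hA] with ω h1 h2 h3
  rw [h1, h2, h3]; split_ifs <;> simp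

theorem ind_nonneg {A : Set Ω} (hA : MeasurableSet A) : 0 ≤ ind P ℝ hA := by
  rw [← AEEqFun.coeFn_le]
  filter_upwards [coeFn_ind (P := P) (𝕜 := ℝ) hA, coeFn_zeroL0 (P := P) (R := ℝ)] with ω h1 h2
  rw [h1, h2]; split_ifs <;> simp

theorem ind_le_one {A : Set Ω} (hA : MeasurableSet A) : ind P ℝ hA ≤ 1 := by
  rw [← AEEqFun.coeFn_le]
  filter_upwards [coeFn_ind (P := P) (𝕜 := ℝ) hA, coeFn_oneL0 (P := P) (R := ℝ)] with ω h1 h2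
  rw [h1, h2]; split_ifs <;> simp

theorem ae_nonneg_of_le {ξ : Ω →ₘ[P] ℝ} (h : 0 ≤ ξ) : ∀ᵐ ω ∂P, 0 ≤ ξ ω := by
  filter_upwards [AEEqFun.coeFn_le.2 h, coeFn_zeroL0 (P := P) (R := ℝ)] with ω h1 h2
  rwa [h2] at h1

theorem ae_le_one_of_le {ξ : Ω →ₘ[P] ℝ} (h : ξ ≤ 1) : ∀ᵐ ω ∂P, ξ ω ≤ 1 := by
  filter_upwards [AEEqFun.coeFn_le.2 h, coeFn_oneL0 (P := P) (R := ℝ)] with ω h1 h2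
  rwa [h2] at h1

theorem nonneg_of_ae {ξ : Ω →ₘ[P] ℝ} (h : ∀ᵐ ω ∂P, 0 ≤ ξ ω) : 0 ≤ ξ := by
  rw [← AEEqFun.coeFn_le]
  filter_upwards [h, coeFn_zeroL0 (P := P) (R := ℝ)] with ω h1 h2
  rwa [h2]

theorem le_one_of_ae {ξ : Ω →ₘ[P] ℝ} (h : ∀ᵐ ω ∂P, ξ ω ≤ 1) : ξ ≤ 1 := by
  rw [← AEEqFun.coeFn_le]
  filter_upwards [h, coeFn_oneL0 (P := P) (R := ℝ)] with ω h1 h2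
  rwa [h2]

/-- A countable measurable cover (up to a null set) is refined by a countable partition. -/
theorem exists_partition_of_cover {U : ℕ → Set Ω} (hU : ∀ n, MeasurableSet (U n))
    (hc : ∀ᵐ ω ∂P, ∃ n, ω ∈ U n) :
    ∃ A : CountablePartition Ω, ∀ n, ∀ᵐ ω ∂P, ω ∈ A.set n → ω ∈ U n := by
  -- A `CountablePartition` must cover all of Ω, so the null set missed by the cover is put into the
  -- member with index 0.
  let V : ℕ → Set Ω := fun n => if n = 0 then U 0 ∪ (⋃ k, U k)ᶜ else U n
  have hV : ∀ n, MeasurableSet (V n) := by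
    intro n
    by_cases h : n = 0
    · simp only [V, h, if_true]
      exact (hU 0).union (MeasurableSet.iUnion hU).compl
    · simp only [V, h, if_false]
      exact hU n
  have hUV : (⋃ n, V n) = univ := by
    refine eq_univ_of_forall fun ω => ?_
    by_cases h : ∃ n, ω ∈ U n
    · obtain ⟨n, hn⟩ := h
      refine mem_iUnion.2 ⟨n, ?_⟩
      by_cases h0 : n = 0
      · subst h0; simp only [V, if_true]; exact Or.inl hn
      · simp only [V, h0, if_false]; exact hn
    · refine mem_iUnion.2 ⟨0, ?_⟩
      simp only [V, if_true]
      exact Or.inr (by simpa using h)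
  refine ⟨⟨disjointed V, fun n => MeasurableSet.disjointed hV n, disjoint_disjointed V,
    by rw [iUnion_disjointed, hUV]⟩, fun n => ?_⟩
  filter_upwards [hc] with ω h hn
  have h1 : ω ∈ V n := disjointed_subset V n hn
  by_cases h0 : n = 0
  · subst h0
    simp only [V, if_true] at h1
    rcases h1 with h1 | h1
    · exact h1
    · exact absurd (mem_iUnion.2 h) h1
  · simpa only [V, h0, if_false] using h1

theorem CountablePartition.exists_mem (A : CountablePartition Ω) (ω : Ω) : ∃ n, ω ∈ A.set n :=
  mem_iUnion.1 (A.iUnion_eq ▸ mem_univ ω)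

theorem CountablePartition.eq_of_mem (A : CountablePartition Ω) {ω : Ω} {m n : ℕ}
    (hm : ω ∈ A.set m) (hn : ω ∈ A.set n) : m = n := by
  by_contra h
  exact (Set.disjoint_left.1 (A.disjoint h)) hm hn

/-- An a.e. property may be checked on the members of a countable partition. -/
theorem CountablePartition.ae_of_forall (A : CountablePartition Ω) {p : Ω → Prop}
    (h : ∀ n, ∀ᵐ ω ∂P, ω ∈ A.set n → p ω) : ∀ᵐ ω ∂P, p ω := by
  filter_upwards [ae_all_iff.2 h] with ω hω
  obtain ⟨n, hn⟩ := A.exists_mem ω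
  exact hω n hn

/-- Random variables can be glued along a countable partition. -/
theorem exists_glueL0 (A : CountablePartition Ω) (g : ℕ → Ω →ₘ[P] ℝ) :
    ∃ ξ : Ω →ₘ[P] ℝ, ∀ n, ∀ᵐ ω ∂P, ω ∈ A.set n → ξ ω = g n ω := by
  choose i hi using A.exists_mem
  have hm : Measurable fun ω => g (i ω) ω := by
    have hi_meas : Measurable i := by
      refine measurable_to_countable' fun n => ?_
      have : i ⁻¹' {n} = A.set n := by
        ext ω
        refine ⟨fun h => ?_, fun h => A.eq_of_mem (hi ω) h⟩
        have h' : i ω = n := h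
        rw [← h']; exact hi ω
      rw [this]; exact A.measurable n
    have h2 : Measurable (Function.uncurry fun (n : ℕ) (ω : Ω) => g n ω) :=
      measurable_from_prod_countable_right fun n => (g n).measurable
    exact h2.comp (hi_meas.prodMk measurable_id)
  refine ⟨AEEqFun.mk _ hm.aestronglyMeasurable, fun n => ?_⟩
  filter_upwards [AEEqFun.coeFn_mk (μ := P) (fun ω => g (i ω) ω) hm.aestronglyMeasurable]
    with ω h hn
  rw [h, A.eq_of_mem (hi ω) hn]

end Scalars

/-! ### Dedekind completeness of L⁰ and approximation by single members of stable families -/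

section Order

variable {P : Measure Ω}

/-- `L⁰(ℱ)` is Dedekind complete, and infima are attained by countable subfamilies. -/
theorem exists_isGLB_countable [IsProbabilityMeasure P] {S : Set (Ω →ₘ[P] ℝ)} (hS : S.Nonempty)
    (hb : BddBelow S) :
    ∃ s, IsGLB S s ∧ ∃ f : ℕ → Ω →ₘ[P] ℝ, (∀ n, f n ∈ S) ∧ ∀ᵐ ω ∂P, IsGLB (range fun n => f n ω) (s ω) := by
  obtain ⟨b, hb⟩ := hb
  have hbae : ∀ f ∈ S, ∀ᵐ ω ∂P, b ω ≤ f ω := fun f hf => AEEqFun.coeFn_le.2 (hb hf)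
  let I : (ℕ → S) → Ω → ℝ := fun c ω => ⨅ n, (c n : Ω →ₘ[P] ℝ) ω
  have hI : ∀ c, Measurable (I c) := fun c => Measurable.iInf fun n => (c n : Ω →ₘ[P] ℝ).measurable
  have hglb : ∀ c : ℕ → S, ∀ᵐ ω ∂P, IsGLB (range fun n => (c n : Ω →ₘ[P] ℝ) ω) (I c ω) := by
    intro c
    filter_upwards [ae_all_iff.2 fun n => hbae _ (c n).2] with ω h
    exact isGLB_ciInf ⟨b ω, by rintro _ ⟨n, rfl⟩; exact h n⟩
  -- The bounded, strictly increasing arctan makes countable infima comparable through finite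
  -- integrals; a countable subfamily minimizing T realizes the infimum.
  let T : (ℕ → S) → ℝ := fun c => ∫ ω, Real.arctan (I c ω) ∂P
  have hint : ∀ c, Integrable (fun ω => Real.arctan (I c ω)) P := by
    intro c
    refine Integrable.of_bound (Real.measurable_arctan.comp (hI c)).aestronglyMeasurable (Real.pi / 2)
      (ae_of_all _ fun ω => ?_)
    rw [Real.norm_eq_abs, abs_le]
    exact ⟨by linarith [Real.neg_pi_div_two_lt_arctan (I c ω)], (Real.arctan_lt_pi_div_two _).le⟩
  have hTb : BddBelow (range T) := by
    refine ⟨-(Real.pi / 2), ?_⟩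
    rintro _ ⟨c, rfl⟩
    have h := integral_mono (μ := P) (integrable_const (-(Real.pi / 2))) (hint c)
      fun ω => (Real.neg_pi_div_two_lt_arctan (I c ω)).le.trans' (by linarith)
    simpa using h
  obtain ⟨s0, hs0⟩ := hS
  have hne : (range T).Nonempty := ⟨_, ⟨fun _ => ⟨s0, hs0⟩, rfl⟩⟩
  have happ : ∀ k : ℕ, ∃ c, T c < sInf (range T) + 1 / ((k : ℝ) + 1) := by
    intro k
    obtain ⟨_, ⟨c, rfl⟩, h⟩ := Real.lt_sInf_add_pos hne (ε := 1 / ((k : ℝ) + 1)) (by positivity)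
    exact ⟨c, h⟩
  choose c hc using happ
  have hle_of : ∀ d e : ℕ → S, (∀ n, ∃ m, d m = e n) → ∀ᵐ ω ∂P, I d ω ≤ I e ω := by
    intro d e hde
    filter_upwards [hglb d, hglb e] with ω h1 h2
    refine h2.2 ?_
    rintro _ ⟨n, rfl⟩
    obtain ⟨m, hm⟩ := hde n
    change _ ≤ (e n : Ω →ₘ[P] ℝ) ω
    rw [← hm]
    exact h1.1 ⟨m, rfl⟩
  have hTle : ∀ d e : ℕ → S, (∀ n, ∃ m, d m = e n) → T d ≤ T e := fun d e hde =>
    integral_mono_ae (hint d) (hint e) ((hle_of d e hde).mono fun ω h => Real.arctan_mono h)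
  -- `d` merges all the nearly minimizing sequences into one, hence attains the infimum of T.
  let d : ℕ → S := fun n => c n.unpair.1 n.unpair.2
  have hd : ∀ k n, ∃ m, d m = c k n := fun k n => ⟨Nat.pair k n, by simp [d]⟩
  have hTd : T d ≤ sInf (range T) := by
    refine le_of_forall_pos_le_add fun ε hε => ?_
    obtain ⟨k, hk⟩ := exists_nat_one_div_lt hε
    have := hc k
    refine le_trans ?_ (add_le_add_right hk.le _)
    exact (hTle d (c k) (hd k)).trans (hc k).le
  have hs : ∀ᵐ ω ∂P, AEEqFun.mk (I d) (hI d).aestronglyMeasurable ω = I d ω :=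
    AEEqFun.coeFn_mk _ _
  refine ⟨AEEqFun.mk (I d) (hI d).aestronglyMeasurable, ⟨?_, ?_⟩, fun n => d n, fun n => (d n).2, ?_⟩
  · intro g hg
    -- Adjoining g cannot lower the minimal integral, so the pointwise infimum is a.e. unchanged and
    -- lies below g.
    let e : ℕ → S := fun n => Nat.casesOn n ⟨g, hg⟩ d
    have h1 : ∀ n, ∃ m, e m = d n := fun n => ⟨n + 1, rfl⟩
    have h2 : T e = T d := le_antisymm (hTle e d h1) (hTd.trans (csInf_le hTb ⟨e, rfl⟩))
    have h3 : (fun ω => Real.arctan (I e ω)) =ᵐ[P] fun ω => Real.arctan (I d ω) :=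
      (integral_eq_iff_of_ae_le (hint e) (hint d)
        ((hle_of e d h1).mono fun ω h => Real.arctan_mono h)).1 h2
    rw [← AEEqFun.coeFn_le]
    filter_upwards [h3, hs, hglb e] with ω h4 h5 h6
    rw [h5, ← Real.arctan_injective h4]
    exact h6.1 ⟨0, rfl⟩
  · intro g hg
    rw [← AEEqFun.coeFn_le]
    filter_upwards [hs, hglb d, ae_all_iff.2 fun n => AEEqFun.coeFn_le.2 (hg (d n).2)] with ω h1 h2 h3
    rw [h1]
    refine h2.2 ?_
    rintro _ ⟨n, rfl⟩
    exact h3 n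
  · filter_upwards [hs, hglb d] with ω h1 h2
    rw [h1]; exact h2

theorem exists_isGLB [IsProbabilityMeasure P] {S : Set (Ω →ₘ[P] ℝ)} (hS : S.Nonempty)
    (hb : BddBelow S) : ∃ s, IsGLB S s :=
  let ⟨s, h, _⟩ := exists_isGLB_countable hS hb
  ⟨s, h⟩

theorem neg_le_negL0 {f g : Ω →ₘ[P] ℝ} (h : f ≤ g) : -g ≤ -f := by
  rw [← AEEqFun.coeFn_le]
  filter_upwards [AEEqFun.coeFn_le.2 h, AEEqFun.coeFn_neg f, AEEqFun.coeFn_neg g] with ω h1 h2 h3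
  rw [h2, h3]; exact neg_le_neg h1

theorem exists_isLUB [IsProbabilityMeasure P] {S : Set (Ω →ₘ[P] ℝ)} (hS : S.Nonempty)
    (hb : BddAbove S) : ∃ s, IsLUB S s := by
  obtain ⟨b, hb⟩ := hb
  obtain ⟨s, hs⟩ := exists_isGLB (S := (fun f => -f) '' S) (hS.image _)
    ⟨-b, by rintro _ ⟨f, hf, rfl⟩; exact neg_le_negL0 (hb hf)⟩
  refine ⟨-s, fun f hf => ?_, fun g hg => ?_⟩
  · simpa using neg_le_negL0 (hs.1 ⟨f, hf, rfl⟩)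
  · refine (neg_le_negL0 (hs.2 (?_ : -g ∈ _))).trans_eq (neg_neg g)
    rintro _ ⟨f, hf, rfl⟩
    exact neg_le_negL0 (hg hf)

/-- In a family of random variables that is stable under countable concatenation, the infimum is
approximated uniformly by a single member. -/
theorem exists_le_add_of_isGLB [IsProbabilityMeasure P] {X : Type*} [Nonempty X]
    {f : X → Ω →ₘ[P] ℝ} {s : Ω →ₘ[P] ℝ} (hs : IsGLB (range f) s)
    (hglue : ∀ (A : CountablePartition Ω) (x : ℕ → X), ∃ z, ∀ n, ∀ᵐ ω ∂P,
      ω ∈ A.set n → f z ω ≤ f (x n) ω) {ε : ℝ} (hε : 0 < ε) :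
    ∃ z, ∀ᵐ ω ∂P, f z ω ≤ s ω + ε := by
  obtain ⟨s', hs', g, hg, hglb⟩ := exists_isGLB_countable (range_nonempty f) ⟨s, hs.1⟩
  obtain rfl : s' = s := hs'.unique hs
  choose x hx using hg
  -- Countably many members have pointwise infimum `s'`, so the events where one of them is within ε
  -- of it cover Ω up to a null set.
  obtain ⟨A, hA⟩ := exists_partition_of_cover (P := P) (U := fun n => {ω | f (x n) ω ≤ s' ω + ε})
    (fun n => measurableSet_le (f (x n)).measurable (s'.measurable.add_const ε)) (by
      filter_upwards [hglb] with ω h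
      obtain ⟨_, ⟨n, rfl⟩, h2⟩ := h.exists_between (lt_add_of_pos_right (s' ω) hε)
      exact ⟨n, by simpa [hx] using h2.2.le⟩)
  obtain ⟨z, hz⟩ := hglue A x
  refine ⟨z, A.ae_of_forall fun n => ?_⟩
  filter_upwards [hz n, hA n] with ω h1 h2 hn
  exact (h1 hn).trans (h2 hn)

/-- In a family of random variables that is stable under countable concatenation, the supremum is
approximated uniformly by a single member. -/
theorem exists_sub_le_of_isLUB [IsProbabilityMeasure P] {X : Type*} [Nonempty X]
    {f : X → Ω →ₘ[P] ℝ} {s : Ω →ₘ[P] ℝ} (hs : IsLUB (range f) s)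
    (hglue : ∀ (A : CountablePartition Ω) (x : ℕ → X), ∃ z, ∀ n, ∀ᵐ ω ∂P,
      ω ∈ A.set n → f (x n) ω ≤ f z ω) {ε : ℝ} (hε : 0 < ε) :
    ∃ z, ∀ᵐ ω ∂P, s ω - ε ≤ f z ω := by
  have hn : ∀ g : Ω →ₘ[P] ℝ, ∀ᵐ ω ∂P, (-g) ω = - g ω := fun g => AEEqFun.coeFn_neg g
  have hs' : IsGLB (range fun x => -f x) (-s) := by
    refine ⟨?_, fun g hg => ?_⟩
    · rintro _ ⟨x, rfl⟩; exact neg_le_negL0 (hs.1 ⟨x, rfl⟩)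
    · refine (neg_neg g).symm.trans_le (neg_le_negL0 (hs.2 ?_))
      rintro _ ⟨x, rfl⟩
      exact (neg_neg (f x)).symm.trans_le (neg_le_negL0 (hg ⟨x, rfl⟩))
  obtain ⟨z, hz⟩ := exists_le_add_of_isGLB hs' (fun A x => by
    obtain ⟨z, hz⟩ := hglue A x
    refine ⟨z, fun n => ?_⟩
    filter_upwards [hz n, hn (f z), hn (f (x n))] with ω h1 h2 h3 h4
    rw [h2, h3]; exact neg_le_neg (h1 h4)) hε
  refine ⟨z, ?_⟩
  filter_upwards [hz, hn s, hn (f z)] with ω h1 h2 h3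
  rw [h2, h3] at h1; linarith

end Order

/-! ### Convergence in probability against almost sure convergence -/

section ConvergenceInMeasure

variable {P : Measure Ω} [IsProbabilityMeasure P]

/-- The hypothesis is convergence in measure, written as in the (ε, λ)-topology. Passing to a
subsequence lets all later topological arguments be carried out pointwise. -/
theorem exists_subseq_tendsto_ae_of_prob {f : ℕ → Ω →ₘ[P] ℝ} (h0 : ∀ n, 0 ≤ f n)
    (h : ∀ ε δ : ℝ, 0 < ε → 0 < δ → ∀ᶠ n in atTop, 1 - δ < P.real {ω | f n ω < ε}) :
    ∃ φ : ℕ → ℕ, StrictMono φ ∧ ∀ᵐ ω ∂P, Tendsto (fun n => f (φ n) ω) atTop (𝓝 0) := by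
  have hm : TendstoInMeasure P (fun n => (f n : Ω → ℝ)) atTop (fun _ => (0 : ℝ)) := by
    rw [tendstoInMeasure_iff_measureReal_norm]
    intro ε hε
    rw [Metric.tendsto_atTop]
    intro δ hδ
    obtain ⟨n0, hn0⟩ := eventually_atTop.1 (h ε δ hε hδ)
    refine ⟨n0, fun n hn => ?_⟩
    rw [Real.dist_eq, sub_zero, abs_of_nonneg measureReal_nonneg]
    have h1 : P.real {ω | ε ≤ ‖f n ω - 0‖} = P.real {ω | f n ω < ε}ᶜ := by
      refine measureReal_congr ?_
      filter_upwards [ae_nonneg_of_le (h0 n)] with ω h2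
      change (ε ≤ ‖f n ω - 0‖) = ¬ (f n ω < ε)
      rw [sub_zero, Real.norm_eq_abs, abs_of_nonneg h2, not_lt]
    rw [h1, probReal_compl_eq_one_sub (measurableSet_lt (f n).measurable measurable_const)]
    linarith [hn0 n hn]
  exact hm.exists_seq_tendsto_ae

theorem eventually_prob_of_tendsto_ae {f : ℕ → Ω →ₘ[P] ℝ}
    (h : ∀ᵐ ω ∂P, Tendsto (fun n => f n ω) atTop (𝓝 0)) {ε δ : ℝ} (hε : 0 < ε) (hδ : 0 < δ) :
    ∀ᶠ n in atTop, 1 - δ < P.real {ω | f n ω < ε} := by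
  have hm := tendstoInMeasure_of_tendsto_ae (g := fun _ => (0 : ℝ))
    (fun n => (f n).aestronglyMeasurable) h
  rw [tendstoInMeasure_iff_measureReal_norm] at hm
  filter_upwards [(hm ε hε).eventually (gt_mem_nhds hδ)] with n hn
  have h1 : P.real {ω | f n ω < ε}ᶜ ≤ P.real {ω | ε ≤ ‖f n ω - 0‖} := by
    refine measureReal_mono fun ω hω => ?_
    have h2 : ¬ f n ω < ε := hω
    change ε ≤ ‖f n ω - 0‖
    rw [sub_zero]
    exact (not_lt.1 h2).trans (le_abs_self _)
  rw [probReal_compl_eq_one_sub (measurableSet_lt (f n).measurable measurable_const)] at h1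
  linarith

end ConvergenceInMeasure

/-! ### Pointwise norm estimates and sequential description of the (ε, λ)-topology -/

section Norm

variable {P : Measure Ω} {𝕜 : Type*} [RCLike 𝕜] {E : Type*} [AddCommGroup E]
  [Module (Ω →ₘ[P] 𝕜) E] (N : L0Norm P 𝕜 E)

theorem L0Norm.ae_nonneg (x : E) : ∀ᵐ ω ∂P, 0 ≤ N x ω := ae_nonneg_of_le (N.nonneg x)

theorem L0Norm.ae_zero : ∀ᵐ ω ∂P, N 0 ω = 0 := by
  rw [N.map_zero]; exact coeFn_zeroL0

theorem L0Norm.ae_smul (ξ : Ω →ₘ[P] ℝ) (x : E) :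
    ∀ᵐ ω ∂P, N (ofRealHom P 𝕜 ξ • x) ω = |ξ ω| * N x ω := by
  filter_upwards [coeFn_mulL0 (modulus (ofRealHom P 𝕜 ξ)) (N x), coeFn_modulus (ofRealHom P 𝕜 ξ),
    coeFn_ofRealL0 (𝕜 := 𝕜) ξ] with ω h1 h2 h3
  rw [N.map_smul, h1, h2, ofRealHom_apply, h3]; simp

theorem L0Norm.ae_add_le (x y : E) : ∀ᵐ ω ∂P, N (x + y) ω ≤ N x ω + N y ω := by
  filter_upwards [AEEqFun.coeFn_le.2 (N.triangle x y), coeFn_addL0 (N x) (N y)] with ω h1 h2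
  rwa [h2] at h1

theorem L0Norm.sub_comm (x y : E) : N (x - y) = N (y - x) := by
  rw [← neg_sub, N.map_neg]

theorem L0Norm.ae_sub_le (x y z : E) : ∀ᵐ ω ∂P, N (x - z) ω ≤ N (x - y) ω + N (y - z) ω := by
  have h := N.ae_add_le (x - y) (y - z)
  rwa [sub_add_sub_cancel] at h

theorem L0Norm.ae_convex (x y z : E) {ξ : Ω →ₘ[P] ℝ} (h0 : 0 ≤ ξ) (h1 : ξ ≤ 1) :
    ∀ᵐ ω ∂P, N (ofRealHom P 𝕜 ξ • x + (1 - ofRealHom P 𝕜 ξ) • y - z) ω ≤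
      ξ ω * N (x - z) ω + (1 - ξ ω) * N (y - z) ω := by
  have e : ofRealHom P 𝕜 ξ • x + (1 - ofRealHom P 𝕜 ξ) • y - z =
      ofRealHom P 𝕜 ξ • (x - z) + ofRealHom P 𝕜 (1 - ξ) • (y - z) := by
    rw [map_sub, map_one]; module
  rw [e]
  filter_upwards [N.ae_add_le (ofRealHom P 𝕜 ξ • (x - z)) (ofRealHom P 𝕜 (1 - ξ) • (y - z)),
    N.ae_smul ξ (x - z), N.ae_smul (1 - ξ) (y - z), ae_nonneg_of_le h0, ae_le_one_of_le h1,
    coeFn_subL0 1 ξ, coeFn_oneL0 (P := P) (R := ℝ)] with ω a1 a2 a3 a4 a5 a6 a7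
  rw [a2, a3, a6, a7, abs_of_nonneg a4, abs_of_nonneg (sub_nonneg.2 a5)] at a1
  exact a1

theorem L0Norm.eq_of_ae {x y : E} (h : ∀ᵐ ω ∂P, N (x - y) ω = 0) : x = y := by
  refine sub_eq_zero.1 (N.eq_zero _ (AEEqFun.ext ?_))
  filter_upwards [h, coeFn_zeroL0 (P := P) (R := ℝ)] with ω h1 h2
  rw [h1, h2]

/-- The norm of I_A(x - y) is I_A‖x - y‖. This translates concatenations, defined through the module
action, into a.e. statements about norms. -/
theorem L0Norm.ind_smul_eq_iff {A : Set Ω} (hA : MeasurableSet A) (x y : E) :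
    ind P 𝕜 hA • x = ind P 𝕜 hA • y ↔ ∀ᵐ ω ∂P, ω ∈ A → N (x - y) ω = 0 := by
  have key := N.ae_smul (ind P ℝ hA) (x - y)
  rw [ofRealHom_apply, ofRealL0_ind, smul_sub] at key
  constructor
  · intro h
    rw [h, sub_self] at key
    filter_upwards [key, N.ae_zero, coeFn_ind (P := P) (𝕜 := ℝ) hA] with ω h1 h2 h3 h4
    rw [h2, h3, if_pos h4] at h1
    simpa using h1.symm
  · intro h
    refine N.eq_of_ae ?_
    filter_upwards [key, h, coeFn_ind (P := P) (𝕜 := ℝ) hA] with ω h1 h2 h3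
    rw [h1, h3]
    by_cases h4 : ω ∈ A
    · rw [h2 h4, mul_zero]
    · rw [if_neg h4]; simp

/-- The concatenation of `x` on `A` with `y` off `A`. -/
theorem L0Norm.ae_piecewise {A : Set Ω} (hA : MeasurableSet A) (x y : E) :
    ∀ᵐ ω ∂P,
      (ω ∈ A → N (ofRealHom P 𝕜 (ind P ℝ hA) • x + (1 - ofRealHom P 𝕜 (ind P ℝ hA)) • y - x) ω = 0)
      ∧ (ω ∉ A →
        N (ofRealHom P 𝕜 (ind P ℝ hA) • x + (1 - ofRealHom P 𝕜 (ind P ℝ hA)) • y - y) ω = 0) := by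
  have e1 : ofRealHom P 𝕜 (ind P ℝ hA) • x + (1 - ofRealHom P 𝕜 (ind P ℝ hA)) • y - x =
      ofRealHom P 𝕜 (1 - ind P ℝ hA) • (y - x) := by
    rw [map_sub, map_one]; module
  have e2 : ofRealHom P 𝕜 (ind P ℝ hA) • x + (1 - ofRealHom P 𝕜 (ind P ℝ hA)) • y - y =
      ofRealHom P 𝕜 (ind P ℝ hA) • (x - y) := by
    module
  rw [e1, e2]
  filter_upwards [N.ae_smul (1 - ind P ℝ hA) (y - x), N.ae_smul (ind P ℝ hA) (x - y),
    coeFn_subL0 1 (ind P ℝ hA), coeFn_oneL0 (P := P) (R := ℝ),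
    coeFn_ind (P := P) (𝕜 := ℝ) hA] with ω h1 h2 h3 h4 h5
  rw [h1, h2, h3, h4, h5]
  constructor
  · intro h; rw [if_pos h]; simp
  · intro h; rw [if_neg h]; simp

variable [IsProbabilityMeasure P]

theorem L0Norm.hasBasis_uniformity :
    (@uniformity E N.uniformSpace).HasBasis (fun p : ℝ × ℝ => 0 < p.1 ∧ 0 < p.2 ∧ p.2 < 1)
      fun p => N.entourage p.1 p.2 := by
  refine ⟨fun V => ?_⟩
  change V ∈ FilterBasis.filter _ ↔ _
  rw [FilterBasis.mem_filter_iff]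
  constructor
  · rintro ⟨_, ⟨ε, δ, h1, h2, h3, rfl⟩, h⟩
    exact ⟨(ε, δ), ⟨h1, h2, h3⟩, h⟩
  · rintro ⟨⟨ε, δ⟩, ⟨h1, h2, h3⟩, h⟩
    exact ⟨_, ⟨ε, δ, h1, h2, h3, rfl⟩, h⟩

theorem L0Norm.mem_cl_iff {S : Set E} {x : E} :
    x ∈ N.cl S ↔ ∀ ε δ : ℝ, 0 < ε → 0 < δ → ∃ y ∈ S, (x, y) ∈ N.entourage ε δ := by
  let _ := N.uniformSpace
  change x ∈ closure S ↔ _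
  rw [mem_closure_iff_nhds_basis (nhds_basis_uniformity' N.hasBasis_uniformity)]
  constructor
  · intro h ε δ hε hδ
    -- The basis only admits δ < 1, hence the cap at 1/2.
    obtain ⟨y, hy, h1⟩ := h (i := (ε, min δ (1 / 2)))
      ⟨hε, lt_min hδ (by norm_num), (min_le_right _ _).trans_lt (by norm_num)⟩
    exact ⟨y, hy, N.entourage_mono le_rfl (min_le_left _ _) h1⟩
  · rintro h ⟨ε, δ⟩ ⟨h1, h2, -⟩
    exact h ε δ h1 h2

/-- The closure in the `(ε, λ)`-topology consists of the a.s. limits of sequences. -/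
theorem L0Norm.mem_cl_iff_seq {S : Set E} {x : E} :
    x ∈ N.cl S ↔ ∃ y : ℕ → E, (∀ n, y n ∈ S) ∧
      ∀ᵐ ω ∂P, Tendsto (fun n => N (x - y n) ω) atTop (𝓝 0) := by
  rw [N.mem_cl_iff]
  constructor
  · intro h
    have h' : ∀ n : ℕ, ∃ y ∈ S, (x, y) ∈ N.entourage (1 / ((n : ℝ) + 1)) (1 / ((n : ℝ) + 1)) :=
      fun n => h _ _ (by positivity) (by positivity)
    choose y hy hxy using h'
    obtain ⟨φ, -, hφ⟩ := exists_subseq_tendsto_ae_of_prob (f := fun n => N (x - y n))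
      (fun n => N.nonneg _) (by
        intro ε δ hε hδ
        have h1 := (tendsto_one_div_add_atTop_nhds_zero_nat : Tendsto
          (fun n : ℕ => 1 / ((n : ℝ) + 1)) atTop (𝓝 0)).eventually (gt_mem_nhds (lt_min hε hδ))
        filter_upwards [h1] with n hn
        exact N.entourage_mono (hn.le.trans (min_le_left _ _)) (hn.le.trans (min_le_right _ _))
          (hxy n))
    exact ⟨fun n => y (φ n), fun n => hy _, hφ⟩
  · rintro ⟨y, hy, h⟩ ε δ hε hδ
    obtain ⟨n, hn⟩ := (eventually_prob_of_tendsto_ae (f := fun n => N (x - y n)) h hε hδ).exists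
    exact ⟨y n, hy n, hn⟩

theorem L0Norm.subset_cl (S : Set E) : S ⊆ N.cl S := by
  let _ := N.uniformSpace
  exact subset_closure

theorem L0Norm.closed_cl (S : Set E) : N.Closed (N.cl S) := by
  let _ := N.uniformSpace
  exact isClosed_closure

theorem L0Norm.Closed.cl_subset {N : L0Norm P 𝕜 E} {S T : Set E} (hT : N.Closed T) (h : S ⊆ T) :
    N.cl S ⊆ T := by
  let _ := N.uniformSpace
  exact closure_minimal h hT

theorem L0Norm.closed_iff_seq {S : Set E} :
    N.Closed S ↔ ∀ (x : E) (y : ℕ → E), (∀ n, y n ∈ S) →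
      (∀ᵐ ω ∂P, Tendsto (fun n => N (x - y n) ω) atTop (𝓝 0)) → x ∈ S := by
  constructor
  · intro h x y hy hxy
    exact h.cl_subset subset_rfl (N.mem_cl_iff_seq.2 ⟨y, hy, hxy⟩)
  · intro h
    let _ := N.uniformSpace
    refine isClosed_of_closure_subset fun x hx => ?_
    obtain ⟨y, hy, hxy⟩ := N.mem_cl_iff_seq.1 hx
    exact h x y hy hxy

/-- A sequence with a.s. summable increments converges a.s. -/
theorem L0Norm.exists_tendsto_of_summable (hE : N.IsComplete) (y : ℕ → E)
    (h : ∀ᵐ ω ∂P, Summable fun n => N (y (n + 1) - y n) ω) :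
    ∃ x, ∀ᵐ ω ∂P, Tendsto (fun n => N (x - y n) ω) atTop (𝓝 0) := by
  have hstep : ∀ᵐ ω ∂P, ∀ n k, N (y (n + k) - y n) ω ≤
      ∑' i, N (y (i + n + 1) - y (i + n)) ω := by
    filter_upwards [h, ae_all_iff.2 fun n => N.ae_nonneg (y (n + 1) - y n), N.ae_zero,
      ae_all_iff.2 fun n => ae_all_iff.2 fun k =>
        N.ae_sub_le (y (n + k + 1)) (y (n + k)) (y n)] with ω h1 h2 h0 h3 n k
    have hs : Summable fun i => N (y (i + n + 1) - y (i + n)) ω :=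
      (summable_nat_add_iff (f := fun i => N (y (i + 1) - y i) ω) n).2 h1
    have : N (y (n + k) - y n) ω ≤ ∑ i ∈ Finset.range k, N (y (i + n + 1) - y (i + n)) ω := by
      induction k with
      | zero => simp [h0]
      | succ k ih =>
        rw [Finset.sum_range_succ]
        have := h3 n k
        rw [show k + n = n + k from add_comm _ _, ← add_assoc]
        linarith
    exact this.trans (hs.sum_le_tsum _ fun i _ => h2 _)
  -- The tail `τ n` dominates the distance from `y n` to every later term at once.
  let τ : ℕ → Ω → ℝ := fun n ω => ∑' i, N (y (i + n + 1) - y (i + n)) ω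
  have hτ : ∀ᵐ ω ∂P, Tendsto (fun n => τ n ω) atTop (𝓝 0) := by
    filter_upwards [h] with ω h1
    exact tendsto_sum_nat_add fun i => N (y (i + 1) - y i) ω
  have hτm : ∀ n, Measurable (τ n) := fun n =>
    Measurable.tsum fun i => (N (y (i + n + 1) - y (i + n))).measurable
  let τ' : ℕ → Ω →ₘ[P] ℝ := fun n => AEEqFun.mk (τ n) (hτm n).aestronglyMeasurable
  have hτ'e : ∀ᵐ ω ∂P, ∀ n, τ' n ω = τ n ω := ae_all_iff.2 fun n => AEEqFun.coeFn_mk _ _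
  have hτ' : ∀ᵐ ω ∂P, Tendsto (fun n => τ' n ω) atTop (𝓝 0) := by
    filter_upwards [hτ, hτ'e] with ω h1 h2
    simpa only [h2] using h1
  let _ := N.uniformSpace
  have : CompleteSpace E := hE
  have hc : CauchySeq y := by
    rw [N.hasBasis_uniformity.cauchySeq_iff']
    rintro ⟨ε, δ⟩ ⟨hε, hδ, -⟩
    obtain ⟨n, hn⟩ := (eventually_prob_of_tendsto_ae hτ' hε hδ).exists
    refine ⟨n, fun m hm => ?_⟩
    obtain ⟨k, rfl⟩ := Nat.exists_eq_add_of_le hm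
    refine lt_of_lt_of_le hn (ENNReal.toReal_mono (measure_ne_top _ _) (measure_mono_ae ?_))
    filter_upwards [hstep, hτ'e] with ω h1 h2 (h3 : τ' n ω < ε)
    rw [h2] at h3
    exact (h1 n k).trans_lt h3
  obtain ⟨x, hx⟩ := cauchySeq_tendsto_of_complete hc
  obtain ⟨φ, hφ, hφt⟩ := exists_subseq_tendsto_ae_of_prob (f := fun n => N (x - y n))
    (fun n => N.nonneg _) (by
      intro ε δ hε hδ
      have h1 : N.entourage ε (min δ (1 / 2)) ∈ uniformity E :=
        N.hasBasis_uniformity.mem_of_mem (i := (ε, min δ (1 / 2)))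
          ⟨hε, lt_min hδ (by norm_num), (min_le_right _ _).trans_lt (by norm_num)⟩
      filter_upwards [hx (UniformSpace.ball_mem_nhds x h1)] with n hn
      exact N.entourage_mono le_rfl (min_le_left _ _) hn)
  refine ⟨x, ?_⟩
  -- Completeness gives a.s. convergence only along φ; since φ n ≥ n, the tail `τ n` bounds the
  -- distance from `y n` to `y (φ n)` and extends it to the whole sequence.
  filter_upwards [hφt, hτ, hstep, ae_all_iff.2 fun n => N.ae_nonneg (x - y n),
    ae_all_iff.2 fun n => ae_all_iff.2 fun m => N.ae_sub_le x (y m) (y n)] with ω h1 h2 h3 h4 h5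
  refine squeeze_zero (fun n => h4 n) (fun n => ?_)
    (by simpa using h1.add h2)
  refine (h5 n (φ n)).trans (add_le_add_right ?_ _)
  obtain ⟨k, hk⟩ := Nat.exists_eq_add_of_le (hφ.id_le n)
  have hk' : φ n = n + k := hk
  rw [hk']
  exact h3 n k

end Norm

/-! ### σ-stability, L⁰-convexity and nested closed convex sets -/

section Stable

variable {P : Measure Ω} {𝕜 : Type*} [RCLike 𝕜] {E : Type*} [AddCommGroup E]
  [Module (Ω →ₘ[P] 𝕜) E] {N : L0Norm P 𝕜 E}

theorem IsL0Convex.combo_mem {S : Set E} (hS : IsL0Convex P 𝕜 S) {x y : E} (hx : x ∈ S)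
    (hy : y ∈ S) {ξ : Ω →ₘ[P] ℝ} (h0 : 0 ≤ ξ) (h1 : ξ ≤ 1) :
    ofRealHom P 𝕜 ξ • x + (1 - ofRealHom P 𝕜 ξ) • y ∈ S :=
  hS.2 x hx y hy ξ h0 h1

theorem IsL0Convex.piecewise_mem {S : Set E} (hS : IsL0Convex P 𝕜 S) {x y : E} (hx : x ∈ S)
    (hy : y ∈ S) {A : Set Ω} (hA : MeasurableSet A) :
    ofRealHom P 𝕜 (ind P ℝ hA) • x + (1 - ofRealHom P 𝕜 (ind P ℝ hA)) • y ∈ S :=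
  hS.combo_mem hx hy (ind_nonneg hA) (ind_le_one hA)

theorem IsSigmaStable.exists_glue {S : Set E} (hS : IsSigmaStable P 𝕜 S) (N : L0Norm P 𝕜 E)
    (A : CountablePartition Ω) (x : ℕ → E) (hx : ∀ n, x n ∈ S) :
    ∃ z ∈ S, ∀ n, ∀ᵐ ω ∂P, ω ∈ A.set n → N (z - x n) ω = 0 := by
  obtain ⟨z, hz, h⟩ := hS.2 A x hx
  exact ⟨z, hz, fun n => (N.ind_smul_eq_iff (A.measurable n) z (x n)).1 (h n)⟩

/-- Closed `L⁰`-convex sets in a complete random normed module are `σ`-stable. -/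
theorem IsL0Convex.isSigmaStable [IsProbabilityMeasure P] {S : Set E} (hS : IsL0Convex P 𝕜 S)
    (hc : N.Closed S) (hE : N.IsComplete) : IsSigmaStable P 𝕜 S := by
  refine ⟨hS.1, fun A x hx => ?_⟩
  -- Step n overwrites the current point by `x n` on `A n`, a convex combination with indicator
  -- weights. At almost every ω only the step whose piece contains ω can change anything, so the
  -- sequence is pointwise eventually constant.
  let y : ℕ → E := fun n => Nat.rec (x 0) (fun n z =>
    ofRealHom P 𝕜 (ind P ℝ (A.measurable n)) • x n +
      (1 - ofRealHom P 𝕜 (ind P ℝ (A.measurable n))) • z) n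
  have hy : ∀ n, y n ∈ S := by
    intro n
    induction n with
    | zero => exact hx 0
    | succ n ih => exact hS.piecewise_mem (hx n) ih (A.measurable n)
  have hstep : ∀ᵐ ω ∂P, ∀ n, (ω ∈ A.set n → N (y (n + 1) - x n) ω = 0) ∧
      (ω ∉ A.set n → N (y (n + 1) - y n) ω = 0) :=
    ae_all_iff.2 fun n => N.ae_piecewise (A.measurable n) (x n) (y n)
  obtain ⟨z, hz⟩ := N.exists_tendsto_of_summable hE y (by
    filter_upwards [hstep] with ω h
    obtain ⟨m, hm⟩ := A.exists_mem ω
    refine summable_of_ne_finset_zero (s := {m}) fun n hn => (h n).2 fun h' => ?_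
    exact hn (by simpa using A.eq_of_mem h' hm))
  refine ⟨z, N.closed_iff_seq.1 hc z y hy hz, fun n => ?_⟩
  rw [N.ind_smul_eq_iff]
  filter_upwards [hstep, hz, N.ae_nonneg (z - x n),
    ae_all_iff.2 fun m => N.ae_sub_le z (y m) (x n),
    ae_all_iff.2 fun m => N.ae_sub_le (y (m + 1)) (y m) (x n)] with ω h1 h2 h3 h4 h5 hn
  have h6 : ∀ m, n + 1 ≤ m → N (y m - x n) ω ≤ 0 := by
    intro m hm
    induction m, hm using Nat.le_induction with
    | base => exact ((h1 n).1 hn).le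
    | succ m hm ih =>
      have : ω ∉ A.set m := fun h' => by have := A.eq_of_mem h' hn; omega
      linarith [h5 m, (h1 m).2 this]
  refine le_antisymm (ge_of_tendsto h2 ?_) h3
  filter_upwards [eventually_ge_atTop (n + 1)] with m hm
  linarith [h4 m, h6 m hm]

theorem isL0Convex_sInter {𝒞 : Set (Set E)} (h : ∀ S ∈ 𝒞, IsL0Convex P 𝕜 S)
    (hn : (⋂₀ 𝒞).Nonempty) : IsL0Convex P 𝕜 (⋂₀ 𝒞) :=
  ⟨hn, fun x hx y hy ξ h0 h1 S hS => (h S hS).2 x (hx S hS) y (hy S hS) ξ h0 h1⟩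

theorem IsL0Convex.cl [IsProbabilityMeasure P] {S : Set E} (hS : IsL0Convex P 𝕜 S) :
    IsL0Convex P 𝕜 (N.cl S) := by
  refine ⟨hS.1.mono (N.subset_cl S), fun x hx y hy ξ h0 h1 => ?_⟩
  rw [N.mem_cl_iff_seq] at hx hy ⊢
  obtain ⟨a, ha, hxa⟩ := hx
  obtain ⟨b, hb, hyb⟩ := hy
  refine ⟨fun n => ofRealHom P 𝕜 ξ • a n + (1 - ofRealHom P 𝕜 ξ) • b n,
    fun n => hS.combo_mem (ha n) (hb n) h0 h1, ?_⟩
  have e : ∀ n, ofRealL0 𝕜 ξ • x + (1 - ofRealL0 𝕜 ξ) • y -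
      (ofRealHom P 𝕜 ξ • a n + (1 - ofRealHom P 𝕜 ξ) • b n) =
      ofRealHom P 𝕜 ξ • (x - a n) + ofRealHom P 𝕜 (1 - ξ) • (y - b n) := by
    intro n
    rw [map_sub, map_one, ← ofRealHom_apply]; module
  simp only [e]
  filter_upwards [hxa, hyb, ae_all_iff.2 fun n => N.ae_smul ξ (x - a n),
    ae_all_iff.2 fun n => N.ae_smul (1 - ξ) (y - b n), ae_all_iff.2 fun n =>
    N.ae_add_le (ofRealHom P 𝕜 ξ • (x - a n)) (ofRealHom P 𝕜 (1 - ξ) • (y - b n)),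
    ae_all_iff.2 fun n =>
    N.ae_nonneg (ofRealHom P 𝕜 ξ • (x - a n) + ofRealHom P 𝕜 (1 - ξ) • (y - b n))]
    with ω h2 h3 h4 h5 h6 h7
  refine squeeze_zero h7 (fun n => (h6 n).trans_eq (by rw [h4, h5])) ?_
  simpa using (h2.const_mul |ξ ω|).add (h3.const_mul |(1 - ξ) ω|)

/-- Random balls on an event meet `L⁰`-convex sets in `L⁰`-convex sets. -/
theorem IsL0Convex.inter_ball {S : Set E} (hS : IsL0Convex P 𝕜 S) (N : L0Norm P 𝕜 E)
    (T : Set E) (B : Set Ω) (ρ : Ω → ℝ)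
    (hn : {x ∈ S | ∀ y ∈ T, ∀ᵐ ω ∂P, ω ∈ B → N (x - y) ω ≤ ρ ω}.Nonempty) :
    IsL0Convex P 𝕜 {x ∈ S | ∀ y ∈ T, ∀ᵐ ω ∂P, ω ∈ B → N (x - y) ω ≤ ρ ω} := by
  refine ⟨hn, fun x hx y hy ξ h0 h1 => ⟨hS.2 x hx.1 y hy.1 ξ h0 h1, fun z hz => ?_⟩⟩
  filter_upwards [hx.2 z hz, hy.2 z hz, N.ae_convex x y z h0 h1, ae_nonneg_of_le h0,
    ae_le_one_of_le h1] with ω h2 h3 h4 h5 h6 hB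
  refine h4.trans ?_
  have := h2 hB
  have := h3 hB
  nlinarith

theorem L0Norm.Closed.inter_ball [IsProbabilityMeasure P] {S : Set E} (hS : N.Closed S)
    (T : Set E) (B : Set Ω) (ρ : Ω → ℝ) :
    N.Closed {x ∈ S | ∀ y ∈ T, ∀ᵐ ω ∂P, ω ∈ B → N (x - y) ω ≤ ρ ω} := by
  rw [N.closed_iff_seq] at hS ⊢
  intro x y hy hxy
  refine ⟨hS x y (fun n => (hy n).1) hxy, fun z hz => ?_⟩
  filter_upwards [hxy, ae_all_iff.2 fun n => (hy n).2 z hz,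
    ae_all_iff.2 fun n => N.ae_sub_le x (y n) z] with ω h1 h2 h3 hB
  have h4 : Tendsto (fun n => N (x - y n) ω + ρ ω) atTop (𝓝 (0 + ρ ω)) := h1.add_const _
  rw [zero_add] at h4
  exact ge_of_tendsto' h4 fun n => (h3 n).trans (add_le_add_right (h2 n hB) _)

theorem L0Norm.IsL0ConvexlyCompact.of_subset [IsProbabilityMeasure P] {G W : Set E}
    (hG : N.IsL0ConvexlyCompact G) (hW : W ⊆ G) (hc : N.Closed W) (hconv : IsL0Convex P 𝕜 W) :
    N.IsL0ConvexlyCompact W :=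
  ⟨hc, hconv, fun 𝒞 h => hG.inter_nonempty 𝒞 fun C hC => ⟨(h C hC).1.trans hW, (h C hC).2⟩⟩

/-- A decreasing sequence of closed `L⁰`-convex subsets of an `L⁰`-convexly compact set has a
common point. -/
theorem L0Norm.IsL0ConvexlyCompact.exists_mem_of_antitone [IsProbabilityMeasure P] {G : Set E}
    (hG : N.IsL0ConvexlyCompact G) {C : ℕ → Set E} (hC : Antitone C) (hsub : ∀ n, C n ⊆ G)
    (hcl : ∀ n, N.Closed (C n)) (hconv : ∀ n, IsL0Convex P 𝕜 (C n)) : ∃ x, ∀ n, x ∈ C n := by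
  obtain ⟨x, hx⟩ := hG.inter_nonempty (range C)
    (by rintro _ ⟨n, rfl⟩; exact ⟨hsub n, hcl n, hconv n⟩) (by
      intro 𝒟 h𝒟 hfin
      -- Outside 𝒟 the index 0 is only a filler that makes the choice function total.
      have : ∀ D : Set E, ∃ n : ℕ, D ∈ 𝒟 → C n = D := by
        intro D
        by_cases h : D ∈ 𝒟
        · obtain ⟨n, hn⟩ := h𝒟 h; exact ⟨n, fun _ => hn⟩
        · exact ⟨0, fun h' => absurd h' h⟩
      choose n hn using this
      obtain ⟨m, hm⟩ := (hfin.image n).bddAbove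
      obtain ⟨x, hx⟩ := (hconv m).1
      refine ⟨x, fun D hD => ?_⟩
      rw [← hn D hD]
      exact hC (hm ⟨D, hD, rfl⟩) hx)
  exact ⟨x, fun n => hx _ ⟨n, rfl⟩⟩

end Stable

/-! ### Chebyshev radius, center and diameter of a.s. bounded sets -/

section Radius

variable {P : Measure Ω} {𝕜 : Type*} [RCLike 𝕜] {E : Type*} [AddCommGroup E]
  [Module (Ω →ₘ[P] 𝕜) E] {N : L0Norm P 𝕜 E}

theorem L0Norm.AsBounded.mono {S T : Set E} (hT : N.AsBounded T) (h : S ⊆ T) : N.AsBounded S :=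
  BddAbove.mono (image_mono h) hT

theorem L0Norm.AsBounded.exists_bound {H : Set E} (hb : N.AsBounded H) :
    ∃ b : Ω →ₘ[P] ℝ, ∀ x ∈ H, ∀ᵐ ω ∂P, N x ω ≤ b ω := by
  obtain ⟨b, hb⟩ := hb
  exact ⟨b, fun x hx => AEEqFun.coeFn_le.2 (hb ⟨x, hx, rfl⟩)⟩

variable [IsProbabilityMeasure P]

/-- Boundedness and nonemptiness rule out the default value 0 of `supL0`. -/
theorem L0Norm.AsBounded.isLUB_radAt {H : Set E} (hb : N.AsBounded H) (hH : H.Nonempty) (x : E) :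
    IsLUB ((fun y => N (x - y)) '' H) (N.radAt H x) := by
  obtain ⟨b, hb⟩ := hb.exists_bound
  obtain ⟨s, hs⟩ := exists_isLUB (S := (fun y => N (x - y)) '' H) (hH.image _) ⟨N x + b, by
    rintro _ ⟨y, hy, rfl⟩
    rw [← AEEqFun.coeFn_le]
    filter_upwards [coeFn_addL0 (N x) b, hb y hy, N.ae_add_le x (-y)] with ω h1 h2 h3
    rw [← sub_eq_add_neg, N.map_neg] at h3
    rw [h1]; linarith⟩
  rwa [L0Norm.radAt, supL0_eq hs]

theorem L0Norm.AsBounded.le_radAt {H : Set E} (hb : N.AsBounded H) (x : E) {y : E} (hy : y ∈ H) :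
    ∀ᵐ ω ∂P, N (x - y) ω ≤ N.radAt H x ω :=
  AEEqFun.coeFn_le.2 ((hb.isLUB_radAt ⟨y, hy⟩ x).1 ⟨y, hy, rfl⟩)

theorem L0Norm.AsBounded.radAt_le {H : Set E} (hb : N.AsBounded H) (hH : H.Nonempty) {x : E}
    {ρ : Ω →ₘ[P] ℝ} (h : ∀ y ∈ H, ∀ᵐ ω ∂P, N (x - y) ω ≤ ρ ω) :
    ∀ᵐ ω ∂P, N.radAt H x ω ≤ ρ ω :=
  AEEqFun.coeFn_le.2 ((hb.isLUB_radAt hH x).2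
    (by rintro _ ⟨y, hy, rfl⟩; exact AEEqFun.coeFn_le.1 (h y hy)))

theorem L0Norm.AsBounded.radAt_nonneg {H : Set E} (hb : N.AsBounded H) (hH : H.Nonempty) (x : E) :
    ∀ᵐ ω ∂P, 0 ≤ N.radAt H x ω := by
  obtain ⟨y, hy⟩ := hH
  filter_upwards [hb.le_radAt x hy, N.ae_nonneg (x - y)] with ω h1 h2
  exact h2.trans h1

theorem L0Norm.AsBounded.radAt_le_add {H : Set E} (hb : N.AsBounded H) (hH : H.Nonempty)
    (x y : E) : ∀ᵐ ω ∂P, N.radAt H x ω ≤ N.radAt H y ω + N (x - y) ω := by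
  have h := hb.radAt_le hH (x := x) (ρ := N.radAt H y + N (x - y)) fun z hz => by
    filter_upwards [hb.le_radAt y hz, coeFn_addL0 (N.radAt H y) (N (x - y)), N.ae_sub_le x y z]
      with ω h1 h2 h3
    rw [h2]; linarith
  filter_upwards [h, coeFn_addL0 (N.radAt H y) (N (x - y))] with ω h1 h2
  rwa [h2] at h1

theorem L0Norm.AsBounded.isGLB_rad {H G : Set E} (hb : N.AsBounded H) (hH : H.Nonempty)
    (hG : G.Nonempty) : IsGLB (N.radAt H '' G) (N.rad H G) := by
  obtain ⟨s, hs⟩ := exists_isGLB (S := N.radAt H '' G) (hG.image _)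
    ⟨0, by rintro _ ⟨x, -, rfl⟩; exact nonneg_of_ae (hb.radAt_nonneg hH x)⟩
  rwa [L0Norm.rad, infL0_eq hs]

theorem L0Norm.AsBounded.rad_le {H G : Set E} (hb : N.AsBounded H) (hH : H.Nonempty) {x : E}
    (hx : x ∈ G) : ∀ᵐ ω ∂P, N.rad H G ω ≤ N.radAt H x ω :=
  AEEqFun.coeFn_le.2 ((hb.isGLB_rad hH ⟨x, hx⟩).1 ⟨x, hx, rfl⟩)

/-- Since R(H, ·) is 1-Lipschitz, its values on an event depend only on the point there.
Concatenating points thus concatenates radii, and the gluing principle for infima applies. -/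
theorem L0Norm.AsBounded.exists_radAt_le {H W : Set E} (hb : N.AsBounded H) (hH : H.Nonempty)
    (hW : IsSigmaStable P 𝕜 W) {ε : ℝ} (hε : 0 < ε) :
    ∃ x ∈ W, ∀ᵐ ω ∂P, N.radAt H x ω ≤ N.rad H W ω + ε := by
  have : Nonempty W := hW.1.to_subtype
  have hglb := hb.isGLB_rad hH hW.1
  rw [image_eq_range] at hglb
  obtain ⟨x, hx⟩ := exists_le_add_of_isGLB hglb (fun A x => by
    obtain ⟨z, hz, h⟩ := hW.exists_glue N A (fun n => (x n : E)) fun n => (x n).2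
    refine ⟨⟨z, hz⟩, fun n => ?_⟩
    filter_upwards [h n, hb.radAt_le_add hH z (x n)] with ω h1 h2 hn
    simpa [h1 hn] using h2) hε
  exact ⟨x, x.2, hx⟩

theorem L0Norm.AsBounded.exists_le_norm_sub {H : Set E} (hb : N.AsBounded H)
    (hH : IsSigmaStable P 𝕜 H) (x : E) {ε : ℝ} (hε : 0 < ε) :
    ∃ y ∈ H, ∀ᵐ ω ∂P, N.radAt H x ω - ε ≤ N (x - y) ω := by
  have : Nonempty H := hH.1.to_subtype
  have hlub := hb.isLUB_radAt hH.1 x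
  rw [image_eq_range] at hlub
  obtain ⟨y, hy⟩ := exists_sub_le_of_isLUB hlub (fun A y => by
    obtain ⟨z, hz, h⟩ := hH.exists_glue N A (fun n => (y n : E)) fun n => (y n).2
    refine ⟨⟨z, hz⟩, fun n => ?_⟩
    filter_upwards [h n, N.ae_sub_le x z (y n)] with ω h1 h2 hn
    simpa [h1 hn] using h2) hε
  exact ⟨y, y.2, hy⟩

theorem L0Norm.AsBounded.isLUB_diam {H : Set E} (hb : N.AsBounded H) (hH : H.Nonempty) :
    IsLUB (image2 (fun x y => N (x - y)) H H) (N.diam H) := by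
  obtain ⟨b, hb⟩ := hb.exists_bound
  obtain ⟨s, hs⟩ := exists_isLUB (S := image2 (fun x y => N (x - y)) H H) (hH.image2 hH)
    ⟨b + b, by
      rintro _ ⟨x, hx, y, hy, rfl⟩
      rw [← AEEqFun.coeFn_le]
      filter_upwards [coeFn_addL0 b b, hb x hx, hb y hy, N.ae_add_le x (-y)] with ω h1 h2 h3 h4
      rw [← sub_eq_add_neg, N.map_neg] at h4
      change N (x - y) ω ≤ _
      rw [h1]; linarith⟩
  rwa [L0Norm.diam, supL0_eq hs]

theorem L0Norm.AsBounded.le_diam {H : Set E} (hb : N.AsBounded H) {x y : E} (hx : x ∈ H)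
    (hy : y ∈ H) : ∀ᵐ ω ∂P, N (x - y) ω ≤ N.diam H ω :=
  AEEqFun.coeFn_le.2 ((hb.isLUB_diam ⟨x, hx⟩).1 ⟨x, hx, y, hy, rfl⟩)

theorem L0Norm.AsBounded.diam_le {H : Set E} (hb : N.AsBounded H) (hH : H.Nonempty)
    {ρ : Ω →ₘ[P] ℝ} (h : ∀ x ∈ H, ∀ y ∈ H, ∀ᵐ ω ∂P, N (x - y) ω ≤ ρ ω) :
    ∀ᵐ ω ∂P, N.diam H ω ≤ ρ ω :=
  AEEqFun.coeFn_le.2 ((hb.isLUB_diam hH).2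
    (by rintro _ ⟨x, hx, y, hy, rfl⟩; exact AEEqFun.coeFn_le.1 (h x hx y hy)))

open Classical in
-- The bound ρ on B, continued by the diameter itself off B, is an upper bound everywhere.
theorem L0Norm.AsBounded.diam_le_on {H : Set E} (hb : N.AsBounded H) (hH : H.Nonempty)
    {B : Set Ω} (hB : MeasurableSet B) {ρ : Ω →ₘ[P] ℝ}
    (h : ∀ x ∈ H, ∀ y ∈ H, ∀ᵐ ω ∂P, ω ∈ B → N (x - y) ω ≤ ρ ω) :
    ∀ᵐ ω ∂P, ω ∈ B → N.diam H ω ≤ ρ ω := by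
  have hm : Measurable (B.piecewise ρ (N.diam H)) := ρ.measurable.piecewise hB (N.diam H).measurable
  have he := AEEqFun.coeFn_mk (μ := P) _ hm.aestronglyMeasurable
  have h1 := hb.diam_le hH (ρ := AEEqFun.mk _ hm.aestronglyMeasurable) fun x hx y hy => by
    filter_upwards [h x hx y hy, hb.le_diam hx hy, he] with ω h1 h2 h3
    rw [h3]
    by_cases h4 : ω ∈ B
    · rw [piecewise_eq_of_mem _ _ _ h4]; exact h1 h4
    · rw [piecewise_eq_of_notMem _ _ _ h4]; exact h2
  filter_upwards [h1, he] with ω h2 h3 h4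
  rwa [h3, piecewise_eq_of_mem _ _ _ h4] at h2

theorem L0Norm.AsBounded.diam_nonneg {H : Set E} (hb : N.AsBounded H) (hH : H.Nonempty) :
    ∀ᵐ ω ∂P, 0 ≤ N.diam H ω := by
  obtain ⟨x, hx⟩ := hH
  filter_upwards [hb.le_diam hx hx, N.ae_nonneg (x - x)] with ω h1 h2
  exact h2.trans h1

theorem L0Norm.AsBounded.radAt_le_diam {H : Set E} (hb : N.AsBounded H) {x : E} (hx : x ∈ H) :
    ∀ᵐ ω ∂P, N.radAt H x ω ≤ N.diam H ω :=
  hb.radAt_le ⟨x, hx⟩ fun _ hy => hb.le_diam hx hy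

/-- Random Chebyshev centers relative to `L⁰`-convexly compact sets are nonempty. -/
theorem L0Norm.IsL0ConvexlyCompact.center_nonempty {H W : Set E} (hW : N.IsL0ConvexlyCompact W)
    (hE : N.IsComplete) (hb : N.AsBounded H) (hH : H.Nonempty) : (N.center H W).Nonempty := by
  let ε : ℕ → ℝ := fun n => 1 / ((n : ℝ) + 1)
  have hε : ∀ n, 0 < ε n := fun n => by positivity
  -- These points of W miss the optimal radius by at most `ε n`. They form decreasing closed
  -- L⁰-convex sets, and a common point is a center.
  let C : ℕ → Set E := fun n =>
    {x ∈ W | ∀ y ∈ H, ∀ᵐ ω ∂P, ω ∈ univ → N (x - y) ω ≤ N.rad H W ω + ε n}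
  have hne : ∀ n, (C n).Nonempty := by
    intro n
    obtain ⟨x, hx, h⟩ := hb.exists_radAt_le hH (hW.convex.isSigmaStable hW.closed hE) (hε n)
    refine ⟨x, hx, fun y hy => ?_⟩
    filter_upwards [h, hb.le_radAt x hy] with ω h1 h2 _
    exact h2.trans h1
  obtain ⟨x, hx⟩ := hW.exists_mem_of_antitone (C := C)
    (fun m n hmn x hx => ⟨hx.1, fun y hy => by
      filter_upwards [hx.2 y hy] with ω h1 h2
      exact (h1 h2).trans (add_le_add_right (Nat.one_div_le_one_div hmn) _)⟩)
    (fun n x hx => hx.1) (fun n => hW.closed.inter_ball _ _ _)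
    (fun n => hW.convex.inter_ball N _ _ _ (hne n))
  refine ⟨x, (hx 0).1, le_antisymm ?_ (AEEqFun.coeFn_le.1 (hb.rad_le hH (hx 0).1))⟩
  refine AEEqFun.coeFn_le.1 (hb.radAt_le hH fun y hy => ?_)
  filter_upwards [ae_all_iff.2 fun n => (hx n).2 y hy] with ω h
  refine ge_of_tendsto' (f := fun n => N.rad H W ω + ε n) (x := atTop) ?_ fun n => h n trivial
  simpa [ε] using (tendsto_const_nhds (x := N.rad H W ω)).add
    (tendsto_one_div_add_atTop_nhds_zero_nat (𝕜 := ℝ))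

end Radius

/-! ### Random complete normal structure implies random normal structure -/

section CompleteToNormal

variable {P : Measure Ω}

theorem MeasureAlgebra.le_one (a : MeasureAlgebra P) :
    a ≤ MeasureAlgebra.mk P MeasurableSet.univ := by
  refine Quotient.inductionOn a fun A => ?_
  change (A : Set Ω) ≤ᵐ[P] (univ : Set Ω)
  exact ae_of_all _ fun _ _ => trivial

/-- With a single index, equality is already regular and gluing is trivial; this supports the
constant net. -/
theorem isStableIndex_bot {X : Type*} [Unique X] :
    IsStableIndex (⊥ : Setoid (X × MeasureAlgebra P)) where
  nonempty := inferInstance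
  regular :=
    { snd_eq := fun _ _ _ _ h => congrArg Prod.snd (Setoid.bot_def ▸ h :)
      mono := fun x y _ b _ _ => by
        rw [Subsingleton.elim x y]
      exists_greatest := fun x y => ⟨MeasureAlgebra.mk P MeasurableSet.univ, by
        rw [Subsingleton.elim x y]
        exact (⊥ : Setoid (X × MeasureAlgebra P)).refl' _, fun a _ => a.le_one⟩
      eq_of_one := fun x y _ => Subsingleton.elim x y }
  exists_gluing := fun A x => ⟨default, fun n => by
    rw [Subsingleton.elim (x n) default]⟩

variable {𝕜 : Type*} [RCLike 𝕜] {E : Type*} [AddCommGroup E]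
  [Module (Ω →ₘ[P] 𝕜) E] {N : L0Norm P 𝕜 E}

theorem concatSets_const (N : L0Norm P 𝕜 E) {H : Set E} (hH : IsSigmaStable P 𝕜 H)
    (A : CountablePartition Ω) :
    concatSets P 𝕜 A (fun _ => H) = H := by
  refine Subset.antisymm ?_ fun z hz => ⟨fun _ => z, fun _ => hz, fun _ => rfl⟩
  rintro z ⟨x, hx, hzx⟩
  obtain ⟨y, hy, hyx⟩ := hH.2 A x hx
  have : z = y := N.eq_of_ae (A.ae_of_forall fun n =>
    (N.ind_smul_eq_iff (A.measurable n) z y).1 ((hzx n).trans (hyx n).symm))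
  rwa [this]

theorem isDecreasingConsistentNet_const (N : L0Norm P 𝕜 E) {X : Type*} [Unique X] [Preorder X]
    {H : Set E} (hH : IsSigmaStable P 𝕜 H) :
    IsDecreasingConsistentNet P 𝕜 (⊥ : Setoid (X × MeasureAlgebra P)) H fun _ => H where
  directed := ⟨fun a b => ⟨a, le_rfl, (Subsingleton.elim b a).le⟩⟩
  stable_index := isStableIndex_bot
  subset _ := subset_rfl
  sigmaStable _ := hH
  consistent A _ _ _ := (concatSets_const N hH A).symm
  decreasing _ _ _ := le_rfl

variable [IsProbabilityMeasure P]

theorem L0Norm.HasRandomCompleteNormalStructure.hasRandomNormalStructure {G : Set E}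
    (hE : N.IsComplete) (h : L0Norm.HasRandomCompleteNormalStructure.{v} N G) :
    N.HasRandomNormalStructure G := by
  refine ⟨h.closed, h.convex, fun H hHG hb hc hconv hD => ?_⟩
  have hst : IsSigmaStable P 𝕜 H := hconv.isSigmaStable hc hE
  have hne : H.Nonempty := hconv.1
  have hnt : H.Nontrivial := by
    by_contra hn
    rw [not_nontrivial_iff] at hn
    refine hD.ne' (le_antisymm (AEEqFun.coeFn_le.1 (hb.diam_le hne fun x hx y hy => ?_)) hD.le)
    rw [hn hx hy, sub_self, N.map_zero]
    exact ae_of_all _ fun _ => le_rfl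
  -- `PUnit.{v + 1}` is the one-point index set living in `Type v`.
  obtain ⟨hK, hB⟩ := h.condition H hHG hc hconv hnt PUnit.{v + 1} ⊥ (fun _ => H)
    (isDecreasingConsistentNet_const N hst) fun _ => rfl
  simp only [iUnion_const] at hK hB
  obtain ⟨z, hzH, hz⟩ : (N.center H H).Nonempty := by
    obtain ⟨x, hx⟩ := hK
    obtain ⟨y, hy, -⟩ := N.mem_cl_iff_seq.1 hx
    exact ⟨_, hy 0⟩
  refine ⟨z, hzH, ?_⟩
  by_contra hcon
  let B : Set Ω := {ω | 0 < N.diam H ω ∧ N.diam H ω ≤ N.radAt H z ω}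
  have hBm : MeasurableSet B :=
    (measurableSet_lt measurable_const (N.diam H).measurable).inter
      (measurableSet_le (N.diam H).measurable (N.radAt H z).measurable)
  have hBpos : 0 < P B := by
    refine pos_iff_ne_zero.2 fun h0 => hcon ?_
    filter_upwards [measure_eq_zero_iff_ae_notMem.1 h0] with ω h1 h2
    by_contra h3
    exact h1 ⟨h2, not_lt.1 h3⟩
  obtain ⟨y, hy, hyK⟩ := hB B hBm (ae_of_all _ fun ω hω => hω.1) hBpos
  -- This is y on B and z off B. It is still a center: on B its radius is at most D(H) ≤ R(H, z),
  -- and off B it has the radius of z.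
  let x := ofRealHom P 𝕜 (ind P ℝ hBm) • y + (1 - ofRealHom P 𝕜 (ind P ℝ hBm)) • z
  have hx : x ∈ H := hconv.piecewise_mem hy hzH hBm
  have hxp := N.ae_piecewise hBm y z
  refine hyK ⟨x, N.subset_cl _ ⟨hx, ?_⟩, ?_⟩
  · refine le_antisymm (AEEqFun.coeFn_le.1 ?_) (AEEqFun.coeFn_le.1 (hb.rad_le hne hx))
    rw [← hz]
    filter_upwards [hxp, hb.radAt_le_add hne x z, hb.radAt_le_diam hx] with ω h1 h2 h3
    by_cases hω : ω ∈ B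
    · exact h3.trans hω.2
    · linarith [h1.2 hω]
  · refine (N.ind_smul_eq_iff hBm x y).2 ?_
    filter_upwards [hxp] with ω h1
    exact h1.1

end CompleteToNormal

/-! ### Near symmetry and absence of recession directions -/

section Bounded

variable {P : Measure Ω}

/-- The inclusion of the real constants in `L⁰(ℱ, 𝕂)`. -/
def realHom (P : Measure Ω) (𝕜 : Type*) [RCLike 𝕜] : ℝ →+* (Ω →ₘ[P] 𝕜) :=
  (ofRealHom P 𝕜).comp (constHom P)

theorem realHom_apply {𝕜 : Type*} [RCLike 𝕜] (c : ℝ) :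
    realHom P 𝕜 c = ofRealHom P 𝕜 (constHom P c) := rfl

variable {𝕜 : Type*} [RCLike 𝕜] {E : Type*} [AddCommGroup E]
  [Module (Ω →ₘ[P] 𝕜) E] {N : L0Norm P 𝕜 E}

theorem L0Norm.ae_realHom_smul (N : L0Norm P 𝕜 E) (c : ℝ) (x : E) :
    ∀ᵐ ω ∂P, N (realHom P 𝕜 c • x) ω = |c| * N x ω := by
  filter_upwards [N.ae_smul (constHom P c) x, coeFn_constHom (P := P) c] with ω h1 h2
  rw [realHom_apply, h1, h2]

theorem IsL0Convex.real_combo_mem {S : Set E} (hS : IsL0Convex P 𝕜 S) {x y : E} (hx : x ∈ S)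
    (hy : y ∈ S) {a b : ℝ} (ha : 0 ≤ a) (hb : 0 ≤ b) (hab : a + b = 1) :
    realHom P 𝕜 a • x + realHom P 𝕜 b • y ∈ S := by
  have h := hS.combo_mem hx hy (constHom_nonneg ha) (constHom_le_one (P := P) (by linarith : a ≤ 1))
  obtain rfl : b = 1 - a := by linarith
  rwa [map_sub, map_one]

theorem IsL0Convex.image_affine {S : Set E} (hS : IsL0Convex P 𝕜 S) (a : E) (τ : ℝ) :
    IsL0Convex P 𝕜 ((fun g => a + realHom P 𝕜 τ • g) '' S) := by
  refine ⟨hS.1.image _, ?_⟩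
  rintro _ ⟨x, hx, rfl⟩ _ ⟨y, hy, rfl⟩ ξ h0 h1
  refine ⟨_, hS.2 x hx y hy ξ h0 h1, ?_⟩
  module

variable [IsProbabilityMeasure P]

theorem L0Norm.Closed.image_affine {S : Set E} (hS : N.Closed S) (a : E) {τ : ℝ} (hτ : 0 < τ) :
    N.Closed ((fun g => a + realHom P 𝕜 τ • g) '' S) := by
  rw [N.closed_iff_seq] at hS ⊢
  intro x y hy hxy
  choose g hg hgy using hy
  have hinv : realHom P 𝕜 τ * realHom P 𝕜 τ⁻¹ = 1 := by
    rw [← map_mul, mul_inv_cancel₀ hτ.ne', map_one]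
  refine ⟨realHom P 𝕜 τ⁻¹ • (x - a), hS _ g hg ?_, ?_⟩
  · have e : ∀ n, realHom P 𝕜 τ⁻¹ • (x - a) - g n = realHom P 𝕜 τ⁻¹ • (x - y n) := by
      intro n
      rw [← hgy n, smul_sub _ x, smul_sub _ x, smul_add, smul_smul, mul_comm, hinv, one_smul,
        sub_sub]
    simp only [e]
    filter_upwards [hxy, ae_all_iff.2 fun n => N.ae_realHom_smul τ⁻¹ (x - y n)] with ω h1 h2
    simp only [h2]
    simpa using h1.const_mul |τ⁻¹|
  · change a + realHom P 𝕜 τ • realHom P 𝕜 τ⁻¹ • (x - a) = x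
    rw [smul_smul, hinv, one_smul, add_sub_cancel]

theorem exists_prob_gt_lt (f : Ω →ₘ[P] ℝ) {η : ℝ} (hη : 0 < η) :
    ∃ K : ℕ, P.real {ω | (K : ℝ) < f ω} < η := by
  have h := tendsto_measure_iInter_atTop (μ := P) (s := fun K : ℕ => {ω | (K : ℝ) < f ω})
    (fun K => (measurableSet_lt measurable_const f.measurable).nullMeasurableSet)
    (fun m n hmn ω (h : (n : ℝ) < f ω) => lt_of_le_of_lt (Nat.cast_le.2 hmn) h)
    ⟨0, measure_ne_top _ _⟩
  have he : (⋂ K : ℕ, {ω | (K : ℝ) < f ω}) = ∅ := by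
    refine eq_empty_of_forall_notMem fun ω hω => ?_
    obtain ⟨n, hn⟩ := exists_nat_gt (f ω)
    exact lt_asymm hn (mem_iInter.1 hω n)
  rw [he, measure_empty] at h
  have h2 := (ENNReal.tendsto_toReal ENNReal.zero_ne_top).comp h
  exact (h2.eventually (gt_mem_nhds (by simpa using hη))).exists

/-- A Baire category argument: an `L⁰`-convexly compact set is nearly symmetric. -/
theorem L0Norm.IsL0ConvexlyCompact.exists_bound_combo {G : Set E} (hG : N.IsL0ConvexlyCompact G)
    {δ : ℝ} (hδ : 0 < δ) : ∃ M : ℝ, ∀ θ : ℝ, 0 < θ → θ ≤ 1 → ∀ g ∈ G, ∃ g' ∈ G,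
      P.real {ω | M < N (g + realHom P 𝕜 θ • g') ω} ≤ δ := by
  by_contra! hcon
  -- If the claim fails, each copy a + τG contains a smaller copy a + τ/(1 + θ)(g + θG), by
  -- convexity, whose points are all large with probability above δ/2. Nesting such copies
  -- contradicts compactness.
  let Aff : E × ℝ → Set E := fun p => (fun g => p.1 + realHom P 𝕜 p.2 • g) '' G
  have hstep : ∀ (n : ℕ) (p : {p : E × ℝ // 0 < p.2}), ∃ q : {p : E × ℝ // 0 < p.2},
      Aff q ⊆ Aff p ∧ ∀ x ∈ Aff q, δ / 2 < P.real {ω | (n : ℝ) < N x ω} := by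
    rintro n ⟨⟨a, τ⟩, hτ⟩
    replace hτ : 0 < τ := hτ
    obtain ⟨K, hK⟩ := exists_prob_gt_lt (N a) (half_pos hδ)
    -- As θ ≤ 1, the scale τ/(1 + θ) is at least τ/2, so exceeding this threshold leaves a norm
    -- above n after discounting ‖a‖ ≤ K.
    obtain ⟨θ, hθ, hθ1, g, hg, hbig⟩ := hcon (2 * (n + K) / τ)
    have h1θ : 0 < 1 + θ := by linarith
    refine ⟨⟨(a + realHom P 𝕜 (τ / (1 + θ)) • g, τ * θ / (1 + θ)), by
      change 0 < τ * θ / (1 + θ); positivity⟩, ?_, ?_⟩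
    · rintro _ ⟨g', hg', rfl⟩
      refine ⟨_, hG.convex.real_combo_mem hg hg' (a := 1 / (1 + θ)) (b := θ / (1 + θ))
        (by positivity) (by positivity) (by field_simp), ?_⟩
      change a + realHom P 𝕜 τ • (realHom P 𝕜 (1 / (1 + θ)) • g + realHom P 𝕜 (θ / (1 + θ)) • g') =
        a + realHom P 𝕜 (τ / (1 + θ)) • g + realHom P 𝕜 (τ * θ / (1 + θ)) • g'
      rw [smul_add, smul_smul, smul_smul, ← map_mul, ← map_mul, mul_one_div, mul_div_assoc,
        add_assoc]
    · rintro _ ⟨g', hg', rfl⟩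
      change δ / 2 < P.real {ω | (n : ℝ) <
        N (a + realHom P 𝕜 (τ / (1 + θ)) • g + realHom P 𝕜 (τ * θ / (1 + θ)) • g') ω}
      have e : a + realHom P 𝕜 (τ / (1 + θ)) • g + realHom P 𝕜 (τ * θ / (1 + θ)) • g' - a =
          realHom P 𝕜 (τ / (1 + θ)) • (g + realHom P 𝕜 θ • g') := by
        rw [smul_add, smul_smul, ← map_mul, show τ / (1 + θ) * θ = τ * θ / (1 + θ) by ring]
        abel
      set x := a + realHom P 𝕜 (τ / (1 + θ)) • g + realHom P 𝕜 (τ * θ / (1 + θ)) • g'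
      have hle : P.real {ω | 2 * (n + K) / τ < N (g + realHom P 𝕜 θ • g') ω} ≤
          P.real ({ω | (n : ℝ) < N x ω} ∪ {ω | (K : ℝ) < N a ω}) := by
        refine ENNReal.toReal_mono (measure_ne_top _ _) (measure_mono_ae ?_)
        filter_upwards [N.ae_realHom_smul (τ / (1 + θ)) (g + realHom P 𝕜 θ • g'),
          N.ae_add_le x (-a)] with ω h1 h2 (h3 : 2 * (n + K) / τ < _)
        rw [← sub_eq_add_neg, N.map_neg, e, h1, abs_of_pos (by positivity)] at h2
        by_cases h4 : (K : ℝ) < N a ω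
        · exact Or.inr h4
        · left
          change (n : ℝ) < N x ω
          rw [div_lt_iff₀ hτ] at h3
          have h5 : τ / 2 ≤ τ / (1 + θ) := div_le_div_of_nonneg_left hτ.le h1θ (by linarith)
          have h6 : 0 ≤ N (g + realHom P 𝕜 θ • g') ω := by
            by_contra h7
            have : (0 : ℝ) ≤ 2 * (n + K) := by positivity
            nlinarith
          have h7 := mul_le_mul_of_nonneg_right h5 h6
          linarith
      have := measureReal_union_le (μ := P) {ω | (n : ℝ) < N x ω} {ω | (K : ℝ) < N a ω}
      linarith [hbig g' hg']
  choose next hnext using hstep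
  let p : ℕ → {p : E × ℝ // 0 < p.2} := fun n => Nat.rec ⟨(0, 1), one_pos⟩ next n
  have hsub : ∀ n, Aff (p n).1 ⊆ G := by
    intro n
    induction n with
    | zero =>
      rintro _ ⟨g, hg, rfl⟩
      change 0 + realHom P 𝕜 1 • g ∈ G
      rwa [map_one, one_smul, zero_add]
    | succ n ih => exact (hnext n (p n)).1.trans ih
  obtain ⟨x, hx⟩ := hG.exists_mem_of_antitone (C := fun n => Aff (p n).1)
    (antitone_nat_of_succ_le fun n => (hnext n (p n)).1) hsub
    (fun n => hG.closed.image_affine (p n).1.1 (p n).2)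
    (fun n => hG.convex.image_affine (p n).1.1 (p n).1.2)
  obtain ⟨K, hK⟩ := exists_prob_gt_lt (N x) (half_pos hδ)
  -- The lower bound at level K holds on the successor copy, hence the index K + 1.
  exact lt_asymm hK ((hnext K (p K)).2 x (hx (K + 1)))

/-- An `L⁰`-convexly compact set has no recession directions. -/
theorem L0Norm.IsL0ConvexlyCompact.recession_eq_zero {G : Set E} (hG : N.IsL0ConvexlyCompact G)
    {c : ℕ → ℝ} (hc0 : ∀ n, 0 ≤ c n) (hc : Tendsto c atTop (𝓝 0)) {g : ℕ → E} (hg : ∀ n, g n ∈ G)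
    {v : E} (hv : ∀ᵐ ω ∂P, Tendsto (fun n => N (realHom P 𝕜 (c n) • g n - v) ω) atTop (𝓝 0)) :
    v = 0 := by
  obtain ⟨x₀, hx₀⟩ := hG.convex.1
  have hmem : ∀ ξ : Ω →ₘ[P] ℝ, 0 ≤ ξ → x₀ + ofRealHom P 𝕜 ξ • v ∈ G := by
    intro ξ hξ
    -- The weight on `g n` is ξ c_n, truncated at 1 to stay convex; pointwise the truncation is
    -- eventually inactive because c_n → 0.
    let η : ℕ → Ω →ₘ[P] ℝ := fun n => (ξ * constHom P (c n)) ⊓ 1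
    have hη : ∀ᵐ ω ∂P, ∀ n, η n ω = min (ξ ω * c n) 1 := by
      rw [ae_all_iff]
      intro n
      filter_upwards [AEEqFun.coeFn_inf (ξ * constHom P (c n)) 1, coeFn_mulL0 ξ (constHom P (c n)),
        coeFn_constHom (P := P) (c n), coeFn_oneL0 (P := P) (R := ℝ)] with ω h1 h2 h3 h4
      rw [h1, h2, h3, h4]
    have hη0 : ∀ n, 0 ≤ η n := fun n => nonneg_of_ae (by
      filter_upwards [hη, ae_nonneg_of_le hξ] with ω h1 h2
      rw [h1]
      exact le_min (mul_nonneg h2 (hc0 n)) zero_le_one)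
    have hη1 : ∀ n, η n ≤ 1 := fun n => le_one_of_ae (by
      filter_upwards [hη] with ω h1
      rw [h1]; exact min_le_right _ _)
    refine N.closed_iff_seq.1 hG.closed _ (fun n => ofRealHom P 𝕜 (η n) • g n +
      (1 - ofRealHom P 𝕜 (η n)) • x₀)
      (fun n => hG.convex.combo_mem (hg n) hx₀ (hη0 n) (hη1 n)) ?_
    have e : ∀ n, x₀ + ofRealHom P 𝕜 ξ • v - (ofRealHom P 𝕜 (η n) • g n +
        (1 - ofRealHom P 𝕜 (η n)) • x₀) = ofRealHom P 𝕜 (-ξ) • (realHom P 𝕜 (c n) • g n - v) +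
        (ofRealHom P 𝕜 (ξ * constHom P (c n) - η n) • g n + ofRealHom P 𝕜 (η n) • x₀) := by
      intro n
      rw [_root_.map_neg, map_sub, map_mul, ← realHom_apply]; module
    simp only [e]
    filter_upwards [hη, hv, ae_nonneg_of_le hξ,
      ae_all_iff.2 fun n => N.ae_smul (-ξ) (realHom P 𝕜 (c n) • g n - v),
      ae_all_iff.2 fun n => N.ae_smul (ξ * constHom P (c n) - η n) (g n),
      ae_all_iff.2 fun n => N.ae_smul (η n) x₀,
      ae_all_iff.2 fun n => N.ae_add_le (ofRealHom P 𝕜 (-ξ) • (realHom P 𝕜 (c n) • g n - v))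
        (ofRealHom P 𝕜 (ξ * constHom P (c n) - η n) • g n + ofRealHom P 𝕜 (η n) • x₀),
      ae_all_iff.2 fun n => N.ae_add_le (ofRealHom P 𝕜 (ξ * constHom P (c n) - η n) • g n)
        (ofRealHom P 𝕜 (η n) • x₀),
      ae_all_iff.2 fun n => N.ae_nonneg
        (ofRealHom P 𝕜 (-ξ) • (realHom P 𝕜 (c n) • g n - v) +
        (ofRealHom P 𝕜 (ξ * constHom P (c n) - η n) • g n + ofRealHom P 𝕜 (η n) • x₀)),
      ae_all_iff.2 fun n => coeFn_subL0 (ξ * constHom P (c n)) (η n),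
      ae_all_iff.2 fun n => coeFn_mulL0 ξ (constHom P (c n)),
      ae_all_iff.2 fun n => coeFn_constHom (P := P) (c n)] with ω a1 a2 a3 a4 a5 a6 a7 a8 a9 b1 b2 b3
    have hξc : Tendsto (fun n => ξ ω * c n) atTop (𝓝 0) := by simpa using hc.const_mul (ξ ω)
    have hlim : Tendsto (fun n => |(-ξ) ω| * N (realHom P 𝕜 (c n) • g n - v) ω +
        |ξ ω * c n| * N x₀ ω) atTop (𝓝 0) := by
      simpa using (a2.const_mul |(-ξ) ω|).add (hξc.abs.mul_const (N x₀ ω))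
    refine squeeze_zero' (Eventually.of_forall a9) ?_ hlim
    filter_upwards [hξc.eventually (gt_mem_nhds one_pos)] with n hn
    have h1 : η n ω = ξ ω * c n := by rw [a1, min_eq_left hn.le]
    have h2 := a7 n
    have h3 := a8 n
    rw [a5, a6, b1, b2, b3, h1, sub_self, abs_zero, zero_mul, zero_add] at h3
    rw [a4] at h2
    linarith
  -- The far parts of the ray from `x₀` along v are nested and convex. A common point of their
  -- closures forces n‖v‖ to be bounded in n.
  let D : ℕ → Set E := fun n =>
    {x | ∃ ξ : Ω →ₘ[P] ℝ, (∀ᵐ ω ∂P, (n : ℝ) ≤ ξ ω) ∧ x = x₀ + ofRealHom P 𝕜 ξ • v}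
  have hD : ∀ n, D n ⊆ G := by
    rintro n _ ⟨ξ, hξ, rfl⟩
    exact hmem ξ (nonneg_of_ae (hξ.mono fun ω h => (Nat.cast_nonneg n).trans h))
  have hDconv : ∀ n, IsL0Convex P 𝕜 (D n) := by
    intro n
    refine ⟨⟨_, constHom P n, (coeFn_constHom (P := P) (n : ℝ)).mono fun ω h => h.ge, rfl⟩, ?_⟩
    rintro _ ⟨ξ, hξ, rfl⟩ _ ⟨ζ, hζ, rfl⟩ η h0 h1
    refine ⟨η * ξ + (1 - η) * ζ, ?_, ?_⟩
    · filter_upwards [hξ, hζ, ae_nonneg_of_le h0, ae_le_one_of_le h1,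
        coeFn_addL0 (η * ξ) ((1 - η) * ζ), coeFn_mulL0 η ξ, coeFn_mulL0 (1 - η) ζ,
        coeFn_subL0 1 η, coeFn_oneL0 (P := P) (R := ℝ)] with ω b1 b2 b3 b4 b5 b6 b7 b8 b9
      rw [b5, b6, b7, b8, b9]
      nlinarith
    · rw [map_add, map_mul, map_mul, map_sub, map_one, ← ofRealHom_apply]; module
  obtain ⟨x, hx⟩ := hG.exists_mem_of_antitone (C := fun n => N.cl (D n))
    (fun m n hmn => (N.closed_cl _).cl_subset (Subset.trans (by
      rintro _ ⟨ξ, hξ, rfl⟩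
      exact ⟨ξ, hξ.mono fun ω h => (Nat.cast_le.2 hmn).trans h, rfl⟩) (N.subset_cl _)))
    (fun n => hG.closed.cl_subset (hD n)) (fun n => N.closed_cl _) (fun n => (hDconv n).cl)
  have hbd : ∀ n : ℕ, ∀ᵐ ω ∂P, n * N v ω ≤ N (x - x₀) ω := by
    intro n
    obtain ⟨y, hy, hxy⟩ := N.mem_cl_iff_seq.1 (hx n)
    choose ξ hξ hyξ using hy
    have e : ∀ k, y k - x₀ = ofRealHom P 𝕜 (ξ k) • v := fun k => by rw [hyξ k]; abel
    filter_upwards [hxy, ae_all_iff.2 hξ, ae_all_iff.2 fun k => N.ae_smul (ξ k) v, N.ae_nonneg v,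
      ae_all_iff.2 fun k => N.ae_sub_le (y k) x x₀] with ω b1 b2 b3 b4 b5
    have h1 : Tendsto (fun k => N (x - y k) ω + N (x - x₀) ω) atTop (𝓝 (0 + N (x - x₀) ω)) :=
      b1.add_const _
    rw [zero_add] at h1
    refine ge_of_tendsto' h1 fun k => ?_
    have h2 := b5 k
    rw [e, b3, N.sub_comm (y k) x] at h2
    refine le_trans ?_ h2
    exact mul_le_mul_of_nonneg_right ((b2 k).trans (le_abs_self _)) b4
  refine N.eq_of_ae ?_
  filter_upwards [ae_all_iff.2 hbd, N.ae_nonneg v] with ω h1 h2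
  rw [sub_zero]
  by_contra h3
  have h4 : 0 < N v ω := lt_of_le_of_ne h2 (Ne.symm h3)
  obtain ⟨n, hn⟩ := exists_nat_gt (N (x - x₀) ω / N v ω)
  rw [div_lt_iff₀ h4] at hn
  exact (h1 n).not_gt hn

end Bounded

/-! ### From boundedness in probability to almost sure boundedness -/

section Bounded

variable {P : Measure Ω} [IsProbabilityMeasure P] {𝕜 : Type*} [RCLike 𝕜] {E : Type*}
  [AddCommGroup E] [Module (Ω →ₘ[P] 𝕜) E] {N : L0Norm P 𝕜 E}

/-- An `L⁰`-convexly compact set is bounded in probability. -/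
theorem L0Norm.IsL0ConvexlyCompact.exists_prob_bound {G : Set E} (hG : N.IsL0ConvexlyCompact G)
    (hE : N.IsComplete) {δ : ℝ} (hδ : 0 < δ) :
    ∃ M : ℝ, ∀ g ∈ G, P {ω | M < N g ω} ≤ ENNReal.ofReal δ := by
  have hδk : ∀ k : ℕ, 0 < δ / 2 / 2 ^ k := fun k => by positivity
  choose M hM using fun k : ℕ => hG.exists_bound_combo (hδk k)
  -- The shift to `M (k + 1)` is deliberate: the next term carries the factor `θ k`, which must
  -- absorb its bound and leave a factor 1/2.
  let θ : ℕ → ℝ := fun k => 1 / (2 * (|M (k + 1)| + 1))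
  have hθ0 : ∀ k, 0 < θ k := fun k => by positivity
  have hθ2 : ∀ k, θ k * (|M (k + 1)| + 1) = 1 / 2 := fun k => by
    have : |M (k + 1)| + 1 ≠ 0 := by positivity
    simp only [θ]; field_simp
  have hθ1 : ∀ k, θ k ≤ 1 / 2 := fun k => by
    have := hθ2 k
    nlinarith [hθ0 k, abs_nonneg (M (k + 1))]
  let c : ℕ → ℝ := fun n => ∏ i ∈ Finset.range n, θ i
  have hc_succ : ∀ n, c (n + 1) = c n * θ n := fun n => Finset.prod_range_succ _ _
  have hc0 : ∀ n, 0 < c n := fun n => Finset.prod_pos fun i _ => hθ0 i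
  have hc1 : ∀ n, c n ≤ (1 / 2) ^ n := by
    intro n
    induction n with
    | zero => simp [c]
    | succ n ih =>
      rw [hc_succ, pow_succ]
      exact mul_le_mul ih (hθ1 n) (hθ0 n).le (by positivity)
  have hclim : Tendsto c atTop (𝓝 0) :=
    squeeze_zero (fun n => (hc0 n).le) hc1
      (tendsto_pow_atTop_nhds_zero_of_lt_one (by norm_num) (by norm_num))
  let a : ℝ := |M 0| + 1
  have ha : 1 ≤ a := by simp [a]
  have hcM : ∀ n, c n * M n ≤ a * (1 / 2) ^ n := by
    intro n
    cases n with
    | zero => simp only [c, Finset.range_zero, Finset.prod_empty, one_mul, pow_zero, mul_one]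
              linarith [le_abs_self (M 0)]
    | succ n =>
      rw [hc_succ]
      have h1 : θ n * M (n + 1) ≤ 1 / 2 := by
        rw [← hθ2 n]
        exact mul_le_mul_of_nonneg_left (by linarith [le_abs_self (M (n + 1))]) (hθ0 n).le
      calc c n * θ n * M (n + 1) = c n * (θ n * M (n + 1)) := by ring
        _ ≤ c n * (1 / 2) := mul_le_mul_of_nonneg_left h1 (hc0 n).le
        _ ≤ (1 / 2) ^ n * (1 / 2) := mul_le_mul_of_nonneg_right (hc1 n) (by norm_num)
        _ = 1 * (1 / 2) ^ (n + 1) := by ring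
        _ ≤ a * (1 / 2) ^ (n + 1) := mul_le_mul_of_nonneg_right ha (by positivity)
  have hgeo : Summable fun n : ℕ => a * (1 / 2 : ℝ) ^ n := summable_geometric_two.mul_left a
  have hgeosum : ∑' n : ℕ, a * (1 / 2 : ℝ) ^ n = a * 2 := by
    rw [tsum_mul_left, tsum_geometric_two]
  refine ⟨a * 2, fun g₀ hg₀ => ?_⟩
  have hnext : ∀ (k : ℕ) (g : G), ∃ g' : G,
      P.real {ω | M k < N ((g : E) + realHom P 𝕜 (θ k) • (g' : E)) ω} ≤ δ / 2 / 2 ^ k := by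
    intro k g
    obtain ⟨g', hg', h⟩ := hM k (θ k) (hθ0 k) ((hθ1 k).trans (by norm_num)) g g.2
    exact ⟨⟨g', hg'⟩, h⟩
  choose next hnext' using hnext
  let g : ℕ → G := fun n => Nat.rec (⟨g₀, hg₀⟩ : G) next n
  let w : ℕ → E := fun n => (g n).1 + realHom P 𝕜 (θ n) • (g (n + 1)).1
  have hw : ∀ n, P.real {ω | M n < N (w n) ω} ≤ δ / 2 / 2 ^ n := fun n => hnext' n (g n)
  have hw' : ∀ n, P {ω | M n < N (w n) ω} ≤ ENNReal.ofReal (δ / 2 / 2 ^ n) := fun n => by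
    rw [← ofReal_measureReal]
    exact ENNReal.ofReal_le_ofReal (hw n)
  have hsumδ : ∑' n : ℕ, ENNReal.ofReal (δ / 2 / 2 ^ n) = ENNReal.ofReal δ := by
    rw [← ENNReal.ofReal_tsum_of_nonneg (fun n => (hδk n).le) (summable_geometric_two' δ),
      tsum_geometric_two']
  have hsum : ∑' n, P {ω | M n < N (w n) ω} ≤ ENNReal.ofReal δ :=
    (ENNReal.tsum_le_tsum hw').trans hsumδ.le
  -- Unrolling g_n = w_n - θ_n g_{n+1} makes `s n` the partial sum of the alternating series with
  -- terms ±c_n w_n.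
  let s : ℕ → E := fun n => g₀ - realHom P 𝕜 ((-1) ^ n * c n) • (g n).1
  have hs0 : s 0 = 0 := by
    change g₀ - realHom P 𝕜 ((-1) ^ 0 * c 0) • g₀ = 0
    simp [c]
  have hsstep : ∀ n, s (n + 1) - s n = realHom P 𝕜 ((-1) ^ n * c n) • w n := by
    intro n
    simp only [s, w]
    rw [hc_succ, smul_add, smul_smul, ← map_mul,
      show (-1 : ℝ) ^ (n + 1) * (c n * θ n) = -((-1) ^ n * c n * θ n) by ring, _root_.map_neg]
    module
  have hNstep : ∀ᵐ ω ∂P, ∀ n, N (s (n + 1) - s n) ω = c n * N (w n) ω := by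
    rw [ae_all_iff]
    intro n
    filter_upwards [N.ae_realHom_smul ((-1) ^ n * c n) (w n)] with ω h1
    rw [hsstep, h1, abs_mul, abs_pow, abs_neg, abs_one, one_pow, one_mul, abs_of_pos (hc0 n)]
  obtain ⟨x, hx⟩ := N.exists_tendsto_of_summable hE s (by
    filter_upwards [hNstep, ae_eventually_notMem (ne_top_of_le_ne_top ENNReal.ofReal_ne_top hsum),
      ae_all_iff.2 fun n => N.ae_nonneg (s (n + 1) - s n)] with ω h1 h2 h3
    refine Summable.of_norm_bounded_eventually_nat hgeo ?_
    filter_upwards [h2] with n hn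
    have h4 : N (w n) ω ≤ M n := not_lt.1 hn
    rw [Real.norm_eq_abs, abs_of_nonneg (h3 n), h1]
    exact (mul_le_mul_of_nonneg_left h4 (hc0 n).le).trans (hcM n))
  -- Along even indices the remainder is `c (2 * n)` times a point of G, with nonnegative
  -- coefficient, so its limit is a recession direction.
  have hxg : g₀ - x = 0 := by
    refine hG.recession_eq_zero (c := fun n => c (2 * n)) (fun n => (hc0 _).le)
      (hclim.comp (tendsto_id.const_mul_atTop' two_pos)) (g := fun n => (g (2 * n)).1)
      (fun n => (g _).2) ?_
    have e : ∀ n, realHom P 𝕜 (c (2 * n)) • (g (2 * n)).1 - (g₀ - x) = x - s (2 * n) := by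
      intro n
      simp only [s, pow_mul, neg_one_sq, one_pow, one_mul]
      abel
    simp only [e]
    filter_upwards [hx] with ω h
    exact h.comp (tendsto_id.const_mul_atTop' two_pos)
  obtain rfl : g₀ = x := sub_eq_zero.1 hxg
  calc P {ω | a * 2 < N g₀ ω} ≤ P (⋃ n, {ω | M n < N (w n) ω}) := by
        refine measure_mono_ae ?_
        filter_upwards [hx, hNstep, ae_all_iff.2 fun n => N.ae_nonneg (s (n + 1) - s n), N.ae_zero,
          ae_all_iff.2 fun n => N.ae_add_le (g₀ - s n) (s n),
          ae_all_iff.2 fun n => N.ae_add_le (s (n + 1) - s n) (s n)]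
          with ω h1 h2 h3 h4 h5 h6 (h7 : a * 2 < N g₀ ω)
        by_contra hcon
        have h8 : ∀ n, N (w n) ω ≤ M n := fun n => not_lt.1 fun h => hcon (mem_iUnion.2 ⟨n, h⟩)
        have h9 : ∀ n, N (s n) ω ≤ ∑ k ∈ Finset.range n, a * (1 / 2 : ℝ) ^ k := by
          intro n
          induction n with
          | zero => simp [hs0, h4]
          | succ n ih =>
            rw [Finset.sum_range_succ]
            have := h6 n
            rw [sub_add_cancel, h2] at this
            have := (mul_le_mul_of_nonneg_left (h8 n) (hc0 n).le).trans (hcM n)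
            linarith
        have h10 : ∀ n, N g₀ ω ≤ N (g₀ - s n) ω + a * 2 := by
          intro n
          have := h5 n
          rw [sub_add_cancel] at this
          have h11 := hgeo.sum_le_tsum (Finset.range n) fun k _ => by positivity
          rw [hgeosum] at h11
          linarith [h9 n]
        have h12 : Tendsto (fun n => N (g₀ - s n) ω + a * 2) atTop (𝓝 (0 + a * 2)) :=
          h1.add_const _
        rw [zero_add] at h12
        exact absurd (ge_of_tendsto' h12 h10) (not_le.2 h7)
    _ ≤ ∑' n, P {ω | M n < N (w n) ω} := measure_iUnion_le _
    _ ≤ ENNReal.ofReal δ := hsum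

/-- Among the events `(‖x‖ > M)`, `x ∈ S`, with `S` a `σ`-stable set, there is a largest one. -/
theorem IsSigmaStable.exists_norm_gt_maximal {S : Set E} (hS : IsSigmaStable P 𝕜 S)
    (N : L0Norm P 𝕜 E) (M : ℝ) :
    ∃ x ∈ S, ∀ y ∈ S, ∀ᵐ ω ∂P, M < N y ω → M < N x ω := by
  classical
  have : Nonempty S := hS.1.to_subtype
  have hm : ∀ x : E, MeasurableSet {ω | M < N x ω} := fun x =>
    measurableSet_lt measurable_const (N x).measurable
  let f : S → Ω →ₘ[P] ℝ := fun x => ind P ℝ (hm x)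
  have hf : ∀ x : S, ∀ᵐ ω ∂P, f x ω = if M < N (x : E) ω then 1 else 0 := fun x =>
    coeFn_ind (P := P) (𝕜 := ℝ) (hm x)
  obtain ⟨s, hs⟩ := exists_isLUB (range_nonempty f)
    ⟨1, by rintro _ ⟨x, rfl⟩; exact ind_le_one (hm x)⟩
  -- The functions are 0/1-valued, so approximating their supremum within 1/2 already gives the
  -- largest event.
  obtain ⟨x, hx⟩ := exists_sub_le_of_isLUB hs (fun A x => by
    obtain ⟨z, hz, h⟩ := hS.exists_glue N A (fun n => (x n : E)) fun n => (x n).2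
    refine ⟨⟨z, hz⟩, fun n => ?_⟩
    filter_upwards [h n, hf ⟨z, hz⟩, hf (x n), N.ae_add_le (x n - z) z] with ω h1 h2 h3 h4 hn
    rw [sub_add_cancel, N.sub_comm, h1 hn, zero_add] at h4
    rw [h2, h3]
    split_ifs with h5 h6
    · exact le_rfl
    · exact absurd (h5.trans_le h4) h6
    · exact zero_le_one
    · exact le_rfl) (one_half_pos)
  refine ⟨x, x.2, fun y hy => ?_⟩
  filter_upwards [hx, hf x, hf ⟨y, hy⟩, AEEqFun.coeFn_le.2 (hs.1 ⟨⟨y, hy⟩, rfl⟩)]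
    with ω h1 h2 h3 h4 h5
  by_contra h6
  rw [h2, if_neg h6] at h1
  rw [h3, if_pos h5] at h4
  linarith

/-- `L⁰`-convexly compact subsets of complete random normed modules are a.s. bounded. -/
theorem L0Norm.IsL0ConvexlyCompact.asBounded {G : Set E} (hG : N.IsL0ConvexlyCompact G)
    (hE : N.IsComplete) : N.AsBounded G := by
  have hst := hG.convex.isSigmaStable hG.closed hE
  -- The maximal event of exceeding `M k` is one event serving all of G. These probabilities are
  -- summable, so almost every ω avoids some such event, and the constants can be glued to a random
  -- bound.
  choose M hM using fun k : ℕ => hG.exists_prob_bound hE (δ := 1 / 2 / 2 ^ k) (by positivity)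
  choose x hxG hx using fun k : ℕ => hst.exists_norm_gt_maximal N (M k)
  have hsum : ∑' k, P {ω | M k < N (x k) ω} ≠ ⊤ := by
    refine ne_top_of_le_ne_top (ENNReal.ofReal_ne_top (r := 1))
      ((ENNReal.tsum_le_tsum fun k => hM k (x k) (hxG k)).trans (le_of_eq ?_))
    rw [← ENNReal.ofReal_tsum_of_nonneg (fun n => by positivity) (summable_geometric_two' 1),
      tsum_geometric_two']
  obtain ⟨A, hA⟩ := exists_partition_of_cover (P := P) (U := fun k => {ω | N (x k) ω ≤ M k})
    (fun k => measurableSet_le (N (x k)).measurable measurable_const) (by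
      filter_upwards [ae_eventually_notMem hsum] with ω h
      obtain ⟨k, hk⟩ := h.exists
      exact ⟨k, not_lt.1 hk⟩)
  obtain ⟨ξ, hξ⟩ := exists_glueL0 (P := P) A fun k => constHom P (M k)
  refine ⟨ξ, ?_⟩
  rintro _ ⟨y, hy, rfl⟩
  refine AEEqFun.coeFn_le.1 (A.ae_of_forall fun k => ?_)
  filter_upwards [hA k, hξ k, hx k y hy, coeFn_constHom (P := P) (M k)] with ω h1 h2 h3 h4 hk
  rw [h2 hk, h4]
  exact not_lt.1 fun h => absurd (h3 h) (not_lt.2 (h1 hk))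

end Bounded

/-- Construction of a sequence by strong recursion, each term being chosen subject to a condition
that involves its predecessors. -/
theorem exists_seq_of_strong_step {α : Type*} [Nonempty α] (p : ℕ → α → Prop)
    (q : ℕ → (ℕ → α) → α → Prop)
    (hq : ∀ n f g v, (∀ i < n, f i = g i) → q n f v → q n g v)
    (h : ∀ n f, (∀ i < n, p i (f i)) → ∃ v, p n v ∧ q n f v) :
    ∃ y : ℕ → α, ∀ n, p n (y n) ∧ q n y (y n) := by
  classical
  choose! next hnext using h
  -- Entries from n on get an arbitrary filler; by `hq` the condition at stage n does not see them.
  let y : ℕ → α := fun n => Nat.strongRecOn n fun n ih =>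
    next n fun i => if hi : i < n then ih i hi else Classical.arbitrary α
  have hy : ∀ n, y n = next n fun i => if i < n then y i else Classical.arbitrary α := by
    intro n
    simp only [y]
    rw [Nat.strongRecOn_eq]
    rfl
  have hp : ∀ n, p n (y n) := by
    intro n
    induction n using Nat.strong_induction_on with
    | _ n ih =>
      rw [hy]
      exact (hnext n _ fun i hi => by rw [if_pos hi]; exact ih i hi).1
  refine ⟨y, fun n => ⟨hp n, ?_⟩⟩
  refine hq n (fun i => if i < n then y i else Classical.arbitrary α) y _
    (fun i hi => if_pos hi) ?_
  rw [hy]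
  exact (hnext n _ fun i hi => by rw [if_pos hi]; exact hp i).2

/-! ### Hulls of nearly diametral sequences -/

section Diametral

variable {P : Measure Ω} {𝕜 : Type*} [RCLike 𝕜] {E : Type*} [AddCommGroup E]
  [Module (Ω →ₘ[P] 𝕜) E] {N : L0Norm P 𝕜 E}

theorem coeFn_sumL0 (ξ : ℕ → Ω →ₘ[P] ℝ) (n : ℕ) :
    ∀ᵐ ω ∂P, (∑ i ∈ Finset.range n, ξ i) ω = ∑ i ∈ Finset.range n, ξ i ω := by
  induction n with
  | zero => simpa using coeFn_zeroL0 (P := P) (R := ℝ)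
  | succ n ih =>
    filter_upwards [ih, coeFn_addL0 (∑ i ∈ Finset.range n, ξ i) (ξ n)] with ω h1 h2
    rw [Finset.sum_range_succ, Finset.sum_range_succ, h2, h1]

theorem L0Norm.ae_sum_le (N : L0Norm P 𝕜 E) (x : ℕ → E) (n : ℕ) :
    ∀ᵐ ω ∂P, N (∑ i ∈ Finset.range n, x i) ω ≤ ∑ i ∈ Finset.range n, N (x i) ω := by
  induction n with
  | zero => simpa using N.ae_zero.mono fun ω h => h.le
  | succ n ih =>
    filter_upwards [ih, N.ae_add_le (∑ i ∈ Finset.range n, x i) (x n)] with ω h1 h2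
    rw [Finset.sum_range_succ, Finset.sum_range_succ]
    linarith

theorem isL0Convex_univ : IsL0Convex P 𝕜 (univ : Set E) :=
  ⟨univ_nonempty, fun _ _ _ _ _ _ _ => trivial⟩

variable (P 𝕜) in
/-- The `L⁰`-convex hull of a sequence. -/
def seqHull (y : ℕ → E) : Set E := ⋂₀ {C | IsL0Convex P 𝕜 C ∧ ∀ i, y i ∈ C}

theorem mem_seqHull (y : ℕ → E) (i : ℕ) : y i ∈ seqHull P 𝕜 y := fun _ hC => hC.2 i

theorem isL0Convex_seqHull (y : ℕ → E) : IsL0Convex P 𝕜 (seqHull P 𝕜 y) :=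
  isL0Convex_sInter (fun _ hC => hC.1) ⟨y 0, mem_seqHull y 0⟩

theorem seqHull_subset {y : ℕ → E} {C : Set E} (hC : IsL0Convex P 𝕜 C) (hy : ∀ i, y i ∈ C) :
    seqHull P 𝕜 y ⊆ C := sInter_subset_of_mem ⟨hC, hy⟩

/-- Finite L⁰-convex combinations form an L⁰-convex set containing the sequence. Asking the
identities only for large n lets two combinations of different lengths be mixed. -/
theorem exists_weights_of_mem_seqHull {y : ℕ → E} {x : E} (hx : x ∈ seqHull P 𝕜 y) :
    ∃ ξ : ℕ → Ω →ₘ[P] ℝ, (∀ i, 0 ≤ ξ i) ∧ ∀ᶠ n in atTop, ∑ i ∈ Finset.range n, ξ i = 1 ∧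
      ∑ i ∈ Finset.range n, ofRealHom P 𝕜 (ξ i) • y i = x := by
  classical
  have hsingle : ∀ k, ∃ ξ : ℕ → Ω →ₘ[P] ℝ, (∀ i, 0 ≤ ξ i) ∧ ∀ᶠ n in atTop,
      ∑ i ∈ Finset.range n, ξ i = 1 ∧
      ∑ i ∈ Finset.range n, ofRealHom P 𝕜 (ξ i) • y i = y k := by
    intro k
    refine ⟨fun i => if i = k then 1 else 0, fun i => ?_, ?_⟩
    · dsimp only
      split_ifs
      · exact nonneg_of_ae ((coeFn_oneL0 (P := P) (R := ℝ)).mono fun ω h => by rw [h]; norm_num)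
      · exact le_rfl
    · filter_upwards [eventually_gt_atTop k] with n hn
      constructor
      · rw [Finset.sum_ite_eq' (Finset.range n) k, if_pos (Finset.mem_range.2 hn)]
      · rw [Finset.sum_eq_single k]
        · rw [if_pos rfl, map_one, one_smul]
        · intro i _ hi
          rw [if_neg hi, map_zero]
          exact zero_smul (Ω →ₘ[P] 𝕜) (y i)
        · intro h
          exact absurd (Finset.mem_range.2 hn) h
  refine seqHull_subset (C := {x | ∃ ξ : ℕ → Ω →ₘ[P] ℝ, (∀ i, 0 ≤ ξ i) ∧ ∀ᶠ n in atTop,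
      ∑ i ∈ Finset.range n, ξ i = 1 ∧
      ∑ i ∈ Finset.range n, ofRealHom P 𝕜 (ξ i) • y i = x}) ⟨⟨y 0, hsingle 0⟩, ?_⟩ hsingle hx
  rintro x ⟨ξ, hξ0, hξ⟩ z ⟨ζ, hζ0, hζ⟩ η h0 h1
  refine ⟨fun i => η * ξ i + (1 - η) * ζ i, fun i => nonneg_of_ae ?_, ?_⟩
  · filter_upwards [ae_nonneg_of_le (hξ0 i), ae_nonneg_of_le (hζ0 i), ae_nonneg_of_le h0,
      ae_le_one_of_le h1, coeFn_addL0 (η * ξ i) ((1 - η) * ζ i), coeFn_mulL0 η (ξ i),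
      coeFn_mulL0 (1 - η) (ζ i), coeFn_subL0 1 η, coeFn_oneL0 (P := P) (R := ℝ)]
      with ω b1 b2 b3 b4 b5 b6 b7 b8 b9
    rw [b5, b6, b7, b8, b9]
    have := sub_nonneg.2 b4
    positivity
  · filter_upwards [hξ, hζ] with n h2 h3
    constructor
    · rw [Finset.sum_add_distrib, ← Finset.mul_sum, ← Finset.mul_sum, h2.1, h3.1]; ring
    · rw [← h2.2, ← h3.2, Finset.smul_sum, Finset.smul_sum, ← Finset.sum_add_distrib]
      refine Finset.sum_congr rfl fun i _ => ?_
      rw [map_add, map_mul, map_mul, map_sub, map_one, ← ofRealHom_apply]; module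

/-- If the averages of the first terms of a sequence are nearly as far as possible from the next
term, then so are all points of its hull. -/
theorem eventually_le_norm_sub_of_mem_seqHull {B : Set Ω} {r : Ω →ₘ[P] ℝ} {y : ℕ → E}
    (hpair : ∀ i j, i < j → ∀ᵐ ω ∂P, ω ∈ B → N (y i - y j) ω ≤ r ω)
    (hmean : ∀ n : ℕ, ∀ᵐ ω ∂P, ω ∈ B → n * (1 - (1 / 2 : ℝ) ^ n) * r ω ≤
      N (∑ i ∈ Finset.range n, (y i - y n)) ω)
    {x : E} (hx : x ∈ seqHull P 𝕜 y) :
    ∀ᶠ n : ℕ in atTop, ∀ᵐ ω ∂P, ω ∈ B → (1 - n * (1 / 2 : ℝ) ^ n) * r ω ≤ N (x - y n) ω := by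
  obtain ⟨ξ, hξ0, hξ⟩ := exists_weights_of_mem_seqHull hx
  filter_upwards [hξ] with n hn
  -- The last sum has weights 1 - ξ_i of total n - 1, hence norm at most (n - 1)r. The left side has
  -- norm at least n(1 - 2⁻ⁿ)r, which leaves (1 - n2⁻ⁿ)r for x - y_n.
  have e : ∑ i ∈ Finset.range n, (y i - y n) = (x - y n) +
      ∑ i ∈ Finset.range n, ofRealHom P 𝕜 (1 - ξ i) • (y i - y n) := by
    have h1 : x - y n = ∑ i ∈ Finset.range n, ofRealHom P 𝕜 (ξ i) • (y i - y n) := by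
      simp only [smul_sub, Finset.sum_sub_distrib]
      rw [hn.2, ← Finset.sum_smul, ← map_sum, hn.1, map_one, one_smul]
    rw [h1, ← Finset.sum_add_distrib]
    refine Finset.sum_congr rfl fun i _ => ?_
    rw [map_sub, map_one]; module
  have hs := coeFn_sumL0 ξ n
  rw [hn.1] at hs
  filter_upwards [hs, coeFn_oneL0 (P := P) (R := ℝ), ae_all_iff.2 fun i => ae_nonneg_of_le (hξ0 i),
    ae_all_iff.2 fun i => N.ae_smul (1 - ξ i) (y i - y n),
    ae_all_iff.2 fun i => coeFn_subL0 1 (ξ i),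
    ae_all_iff.2 fun i => ae_all_iff.2 fun h : i < n => hpair i n h, hmean n,
    N.ae_sum_le (fun i => ofRealHom P 𝕜 (1 - ξ i) • (y i - y n)) n,
    N.ae_add_le (x - y n) (∑ i ∈ Finset.range n, ofRealHom P 𝕜 (1 - ξ i) • (y i - y n))]
    with ω a1 a2 a3 a4 a5 a6 a7 a8 a9 hB
  rw [a2] at a1
  rw [← e] at a9
  have h1 : ∀ i ∈ Finset.range n, ξ i ω ≤ 1 := fun i hi => by
    rw [a1]
    exact Finset.single_le_sum (f := fun i => ξ i ω) (fun j _ => a3 j) hi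
  have h2 : ∑ i ∈ Finset.range n, N (ofRealHom P 𝕜 (1 - ξ i) • (y i - y n)) ω ≤
      ∑ i ∈ Finset.range n, (1 - ξ i ω) * r ω := by
    refine Finset.sum_le_sum fun i hi => ?_
    rw [a4, a5, a2, abs_of_nonneg (sub_nonneg.2 (h1 i hi))]
    exact mul_le_mul_of_nonneg_left (a6 i (Finset.mem_range.1 hi) hB) (sub_nonneg.2 (h1 i hi))
  rw [← Finset.sum_mul, Finset.sum_sub_distrib, ← a1, Finset.sum_const, Finset.card_range,
    nsmul_eq_mul, mul_one] at h2
  have h3 := a7 hB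
  nlinarith

/-- Avoiding division keeps n = 0 in the statement, where any point of W serves. -/
theorem IsL0Convex.exists_mean {W : Set E} (hconv : IsL0Convex P 𝕜 W) (y : ℕ → E) (n : ℕ)
    (hy : ∀ i < n, y i ∈ W) :
    ∃ m ∈ W, realHom P 𝕜 n • m = ∑ i ∈ Finset.range n, y i := by
  induction n with
  | zero =>
    obtain ⟨m, hm⟩ := hconv.1
    refine ⟨m, hm, ?_⟩
    rw [Nat.cast_zero, map_zero, Finset.sum_range_zero]
    exact zero_smul (Ω →ₘ[P] 𝕜) m
  | succ n ih =>
    obtain ⟨m, hm, h⟩ := ih fun i hi => hy i (by omega)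
    have hn : ((n : ℝ) + 1) ≠ 0 := by positivity
    refine ⟨_, hconv.real_combo_mem hm (hy n (by omega)) (a := n / (n + 1)) (b := 1 / (n + 1))
      (by positivity) (by positivity) (by field_simp), ?_⟩
    rw [Finset.sum_range_succ, ← h, smul_add, smul_smul, smul_smul, ← map_mul, ← map_mul]
    push_cast
    rw [mul_div_cancel₀ _ hn, mul_one_div_cancel hn, map_one, one_smul]

variable [IsProbabilityMeasure P]

/-- The closed hull of a sequence whose terms are nearly diametral is diametral on `B`. -/
theorem L0Norm.AsBounded.exists_diametral {W : Set E} (hb : N.AsBounded W) (hc : N.Closed W)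
    (hconv : IsL0Convex P 𝕜 W) {B : Set Ω} (hB : MeasurableSet B) {r : Ω →ₘ[P] ℝ} {y : ℕ → E}
    (hr : ∀ᵐ ω ∂P, ω ∈ B → 0 ≤ r ω) (hy : ∀ i, y i ∈ W)
    (hpair : ∀ i j, i < j → ∀ᵐ ω ∂P, ω ∈ B → N (y i - y j) ω ≤ r ω)
    (hmean : ∀ n : ℕ, ∀ᵐ ω ∂P, ω ∈ B → n * (1 - (1 / 2 : ℝ) ^ n) * r ω ≤
      N (∑ i ∈ Finset.range n, (y i - y n)) ω) :
    ∃ H ⊆ W, N.Closed H ∧ IsL0Convex P 𝕜 H ∧ (∀ᵐ ω ∂P, ω ∈ B → N.diam H ω ≤ r ω) ∧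
      ∀ z ∈ H, ∀ᵐ ω ∂P, ω ∈ B → r ω ≤ N.radAt H z ω := by
  let S := seqHull P 𝕜 y
  have hS : IsL0Convex P 𝕜 S := isL0Convex_seqHull y
  have hHW : N.cl S ⊆ W := hc.cl_subset (seqHull_subset hconv hy)
  have hbH : N.AsBounded (N.cl S) := hb.mono hHW
  have hne : (N.cl S).Nonempty := hS.cl.1
  -- `T Z` is closed and, when nonempty, L⁰-convex. The bound thus passes from the sequence to its
  -- closed hull in one variable, then by symmetry in the other.
  let T : Set E → Set E := fun Z => {x ∈ univ | ∀ z ∈ Z, ∀ᵐ ω ∂P, ω ∈ B → N (x - z) ω ≤ r ω}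
  have hsymm : ∀ {Z Z' : Set E}, Z ⊆ T Z' → Z' ⊆ T Z := fun h z' hz' =>
    ⟨trivial, fun z hz => by rw [N.sub_comm]; exact (h hz).2 z' hz'⟩
  have hTS : ∀ {Z : Set E}, range y ⊆ T Z → S ⊆ T Z := fun {Z} h =>
    seqHull_subset (isL0Convex_univ.inter_ball N Z B r ⟨y 0, h ⟨0, rfl⟩⟩) fun i => h ⟨i, rfl⟩
  have hTcl : ∀ {Z : Set E}, S ⊆ T Z → N.cl S ⊆ T Z := fun {Z} h =>
    L0Norm.Closed.cl_subset (L0Norm.Closed.inter_ball (N := N)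
      (N.closed_iff_seq.2 fun _ _ _ _ => trivial) Z B r) h
  have h0 : range y ⊆ T (range y) := by
    rintro _ ⟨i, rfl⟩
    refine ⟨trivial, ?_⟩
    rintro _ ⟨j, rfl⟩
    rcases lt_trichotomy i j with h | rfl | h
    · exact hpair i j h
    · filter_upwards [hr, N.ae_zero] with ω h1 h2 h3
      rw [sub_self, h2]; exact h1 h3
    · rw [N.sub_comm]; exact hpair j i h
  have h1 : N.cl S ⊆ T (N.cl S) := hTcl (hsymm (hTcl (hTS (hsymm (hTS h0)))))
  refine ⟨N.cl S, hHW, N.closed_cl S, hS.cl,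
    hbH.diam_le_on hne hB fun x hx z hz => (h1 hx).2 z hz, fun z hz => ?_⟩
  obtain ⟨x, hx, hzx⟩ := N.mem_cl_iff_seq.1 hz
  -- Testing `x k` against far terms `y n` works because n2⁻ⁿ → 0; the limit in k afterwards covers
  -- points of the closure.
  have hstep : ∀ k, ∀ᵐ ω ∂P, ω ∈ B → r ω ≤ N.radAt (N.cl S) z ω + N (z - x k) ω := by
    intro k
    obtain ⟨n₀, hn₀⟩ := eventually_atTop.1
      (eventually_le_norm_sub_of_mem_seqHull (N := N) hpair hmean (hx k))
    filter_upwards [ae_all_iff.2 fun n => ae_all_iff.2 fun h : n₀ ≤ n => hn₀ n h,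
      ae_all_iff.2 fun n => hbH.le_radAt z (N.subset_cl S (mem_seqHull y n)),
      ae_all_iff.2 fun n => N.ae_sub_le (x k) z (y n)] with ω a1 a2 a3 hω
    have hlim : Tendsto (fun n : ℕ => (1 - n * (1 / 2 : ℝ) ^ n) * r ω) atTop (𝓝 ((1 - 0) * r ω)) :=
      (tendsto_const_nhds.sub (tendsto_self_mul_const_pow_of_lt_one (by norm_num)
        (by norm_num))).mul_const _
    rw [sub_zero, one_mul] at hlim
    refine le_of_tendsto hlim ?_
    filter_upwards [eventually_ge_atTop n₀] with n hn
    have := a1 n hn hω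
    have := a3 n
    rw [N.sub_comm (x k) z] at this
    linarith [a2 n]
  filter_upwards [ae_all_iff.2 hstep, hzx] with ω a1 a2 hω
  have hlim : Tendsto (fun k => N.radAt (N.cl S) z ω + N (z - x k) ω) atTop
      (𝓝 (N.radAt (N.cl S) z ω + 0)) := a2.const_add _
  rw [add_zero] at hlim
  exact ge_of_tendsto' hlim fun k => a1 k hω

end Diametral

/-! ### Random normal structure implies random complete normal structure -/

section NormalToComplete

variable {P : Measure Ω} {𝕜 : Type*} [RCLike 𝕜] {E : Type*} [AddCommGroup E]
  [Module (Ω →ₘ[P] 𝕜) E] {N : L0Norm P 𝕜 E}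

/-- If every finite subset of `W` has nearly `r`-diametral points, and `w` is `r`-central in `W`,
then there is a sequence in `W` as required for a diametral closed hull. -/
theorem IsL0Convex.exists_nearly_diametral_seq {W : Set E} (hconv : IsL0Convex P 𝕜 W) {B : Set Ω}
    {r : Ω →ₘ[P] ℝ} {c : ℝ} (hc : 0 < c) (hr : ∀ᵐ ω ∂P, ω ∈ B → c ≤ r ω) {w : E} (hw : w ∈ W)
    (hwr : ∀ x ∈ W, ∀ᵐ ω ∂P, ω ∈ B → N (x - w) ω ≤ r ω)
    (hlim : ∀ Z : Finset E, (∀ z ∈ Z, z ∈ W) → ∀ m ∈ W, ∀ ε : ℝ, 0 < ε → ∃ u ∈ W,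
      (∀ z ∈ Z, ∀ᵐ ω ∂P, ω ∈ B → N (z - u) ω ≤ r ω + ε) ∧
      ∀ᵐ ω ∂P, ω ∈ B → r ω - ε ≤ N (m - u) ω) :
    ∃ y : ℕ → E, (∀ i, y i ∈ W) ∧
      (∀ i j, i < j → ∀ᵐ ω ∂P, ω ∈ B → N (y i - y j) ω ≤ r ω) ∧
      ∀ n : ℕ, ∀ᵐ ω ∂P, ω ∈ B → n * (1 - (1 / 2 : ℝ) ^ n) * r ω ≤
        N (∑ i ∈ Finset.range n, (y i - y n)) ω := by
  classical
  let t : ℕ → ℝ := fun n => (1 / 2 : ℝ) ^ (n + 1)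
  have ht0 : ∀ n, 0 < t n := fun n => by positivity
  have ht1 : ∀ n, t n ≤ 1 := fun n => pow_le_one₀ (by norm_num) (by norm_num)
  have htmono : ∀ i n, i < n → t n ≤ t i := fun i n h =>
    pow_le_pow_of_le_one (by norm_num) (by norm_num) (by omega)
  have ht2 : ∀ n, (1 / 2 : ℝ) ^ n = 2 * t n := fun n => by simp only [t, pow_succ]; ring
  have hE : Nonempty E := ⟨w⟩
  obtain ⟨y, hy⟩ := exists_seq_of_strong_step (α := E)
    (fun n v => v ∈ W ∧ ∀ᵐ ω ∂P, ω ∈ B → N (v - w) ω ≤ (1 - t n) * r ω)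
    (fun n f v => (∀ i < n, ∀ᵐ ω ∂P, ω ∈ B → N (f i - v) ω ≤ r ω) ∧
      ∀ᵐ ω ∂P, ω ∈ B → n * (1 - 2 * t n) * r ω ≤ N (∑ i ∈ Finset.range n, (f i - v)) ω)
    (by
      intro n f g v hfg h
      refine ⟨fun i hi => by rw [← hfg i hi]; exact h.1 i hi, ?_⟩
      rw [Finset.sum_congr rfl fun i hi => by rw [← hfg i (Finset.mem_range.1 hi)]]
      exact h.2)
    (by
      intro n f hf
      obtain ⟨m, hm, hmf⟩ := hconv.exists_mean f n fun i hi => (hf i hi).1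
      -- Each earlier term has slack t_i r in its distance to w, so moving by t_n towards w gains
      -- t_n t_i r ≥ t_n² c. This is exactly the error allowed for u.
      have hε : 0 < t n * t n * c := mul_pos (mul_pos (ht0 n) (ht0 n)) hc
      obtain ⟨u, hu, huZ, hum⟩ := hlim ((Finset.range n).image f) (by
        intro z hz
        obtain ⟨i, hi, rfl⟩ := Finset.mem_image.1 hz
        exact (hf i (Finset.mem_range.1 hi)).1) m hm _ hε
      have huf : ∀ i < n, ∀ᵐ ω ∂P, ω ∈ B → N (f i - u) ω ≤ r ω + t n * t n * c := fun i hi =>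
        huZ _ (Finset.mem_image_of_mem f (Finset.mem_range.2 hi))
      have hone : realHom P 𝕜 (1 - t n) = 1 - realHom P 𝕜 (t n) := by rw [map_sub, map_one]
      -- The contraction restores the exact bound r to earlier terms and creates the slack for later
      -- ones. It costs at most t_n r in the distance to the mean, and t_n² c ≤ t_n r accounts for
      -- the factor 1 - 2t_n.
      let x := realHom P 𝕜 (1 - t n) • u + realHom P 𝕜 (t n) • w
      have hxw : x - w = realHom P 𝕜 (1 - t n) • (u - w) := by
        simp only [x, hone]; module
      have hux : u - x = realHom P 𝕜 (t n) • (u - w) := by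
        simp only [x, hone]; module
      have hfx : ∀ i, f i - x =
          realHom P 𝕜 (1 - t n) • (f i - u) + realHom P 𝕜 (t n) • (f i - w) := by
        intro i; simp only [x, hone]; module
      have hsum : ∑ i ∈ Finset.range n, (f i - x) = realHom P 𝕜 n • (m - x) := by
        have hnx : realHom P 𝕜 n • x = n • x := by
          rw [map_natCast]
          exact Nat.cast_smul_eq_nsmul (Ω →ₘ[P] 𝕜) n x
        rw [Finset.sum_sub_distrib, ← hmf, Finset.sum_const, Finset.card_range, smul_sub, hnx]
      have h1t : 0 ≤ 1 - t n := sub_nonneg.2 (ht1 n)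
      refine ⟨x, ⟨hconv.real_combo_mem hu hw h1t (ht0 n).le (by ring), ?_⟩, fun i hi => ?_, ?_⟩
      · rw [hxw]
        filter_upwards [N.ae_realHom_smul (1 - t n) (u - w), hwr u hu] with ω a1 a2 hω
        rw [a1, abs_of_nonneg h1t]
        exact mul_le_mul_of_nonneg_left (a2 hω) h1t
      · rw [hfx]
        filter_upwards [N.ae_add_le (realHom P 𝕜 (1 - t n) • (f i - u))
          (realHom P 𝕜 (t n) • (f i - w)), N.ae_realHom_smul (1 - t n) (f i - u),
          N.ae_realHom_smul (t n) (f i - w), huf i hi, (hf i hi).2, hr] with ω a1 a2 a3 a4 a5 a6 hω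
        rw [a2, a3, abs_of_nonneg h1t, abs_of_pos (ht0 n)] at a1
        have b1 := mul_le_mul_of_nonneg_left (a4 hω) h1t
        have b2 := mul_le_mul_of_nonneg_left (a5 hω) (ht0 n).le
        have b3 : t n * c ≤ t i * r ω :=
          mul_le_mul (htmono i n hi) (a6 hω) hc.le (ht0 i).le
        have b4 := mul_le_mul_of_nonneg_left b3 (ht0 n).le
        have b5 : 0 ≤ t n * (t n * t n * c) := mul_nonneg (ht0 n).le hε.le
        nlinarith
      · rw [hsum]
        filter_upwards [N.ae_realHom_smul (n : ℝ) (m - x), N.ae_sub_le m x u, hum, hwr u hu, hr,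
          N.ae_realHom_smul (t n) (u - w)] with ω a1 a2 a3 a4 a5 a6 hω
        rw [a1, Nat.abs_cast, mul_assoc]
        refine mul_le_mul_of_nonneg_left ?_ (Nat.cast_nonneg n)
        rw [N.sub_comm x u, hux, a6, abs_of_pos (ht0 n)] at a2
        have b1 := mul_le_mul_of_nonneg_left (a4 hω) (ht0 n).le
        have b2 : t n * c ≤ 1 * r ω := mul_le_mul (ht1 n) (a5 hω) hc.le zero_le_one
        have b3 := mul_le_mul_of_nonneg_left b2 (ht0 n).le
        linarith [a3 hω])
  refine ⟨y, fun i => (hy i).1.1, fun i j hij => (hy j).2.1 i hij, fun n => ?_⟩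
  rw [ht2]
  exact (hy n).2.2

variable [IsProbabilityMeasure P]

/-- Along a decreasing consistent net, `R(W_α, x)` comes uniformly close to its infimum. -/
theorem IsDecreasingConsistentNet.exists_radAt_le {Λ : Type v} [Preorder Λ]
    {r : Setoid (Λ × MeasureAlgebra P)} {W : Set E} {F : Λ → Set E}
    (hF : IsDecreasingConsistentNet P 𝕜 r W F) (hb : N.AsBounded W) (x : E) {B : Set Ω}
    {ρ : Ω →ₘ[P] ℝ}
    (hρ : ∀ s : Ω →ₘ[P] ℝ, (∀ α, ∀ᵐ ω ∂P, s ω ≤ N.radAt (F α) x ω) → ∀ᵐ ω ∂P, ω ∈ B → s ω ≤ ρ ω)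
    {ε : ℝ} (hε : 0 < ε) : ∃ α, ∀ᵐ ω ∂P, ω ∈ B → N.radAt (F α) x ω ≤ ρ ω + ε := by
  have hΛ : Nonempty Λ := hF.stable_index.nonempty
  have hbF : ∀ α, N.AsBounded (F α) := fun α => hb.mono (hF.subset α)
  have hne : ∀ α, (F α).Nonempty := fun α => (hF.sigmaStable α).1
  obtain ⟨s, hs⟩ := exists_isGLB (range_nonempty fun α => N.radAt (F α) x)
    ⟨0, by rintro _ ⟨α, rfl⟩; exact nonneg_of_ae ((hbF α).radAt_nonneg (hne α) x)⟩
  obtain ⟨α, hα⟩ := exists_le_add_of_isGLB hs (fun A α => by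
    -- By consistency each point of `F β` agrees on `A n` with a point of `F (α n)`, so its radius
    -- about x is no larger there.
    obtain ⟨β, hβ⟩ := hF.stable_index.exists_gluing A α
    obtain ⟨ξ, hξ⟩ := exists_glueL0 (P := P) A fun n => N.radAt (F (α n)) x
    have h := (hbF β).radAt_le (hne β) (x := x) (ρ := ξ) fun y hy => by
      rw [hF.consistent A α β hβ] at hy
      obtain ⟨z, hz, hyz⟩ := hy
      refine A.ae_of_forall fun n => ?_
      filter_upwards [hξ n, (N.ind_smul_eq_iff (A.measurable n) y (z n)).1 (hyz n),
        (hbF (α n)).le_radAt x (hz n), N.ae_sub_le x (z n) y] with ω a1 a2 a3 a4 hn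
      rw [N.sub_comm (z n) y, a2 hn, add_zero] at a4
      rw [a1 hn]
      exact a4.trans a3
    refine ⟨β, fun n => ?_⟩
    filter_upwards [h, hξ n] with ω a1 a2 hn
    rw [← a2 hn]
    exact a1) hε
  refine ⟨α, ?_⟩
  filter_upwards [hα, hρ s fun α => AEEqFun.coeFn_le.2 (hs.1 ⟨α, rfl⟩)] with ω a1 a2 hω
  linarith [a2 hω]

theorem L0Norm.IsL0ConvexlyCompact.hasRandomCompleteNormalStructure {G : Set E}
    (hG : N.IsL0ConvexlyCompact G) (hE : N.IsComplete) (h : N.HasRandomNormalStructure G) :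
    L0Norm.HasRandomCompleteNormalStructure.{v} N G := by
  have hbG := hG.asBounded hE
  refine ⟨hbG, hG.closed, hG.convex, fun W hWG hc hconv hnt Λ _ ρ F hF hrad => ?_⟩
  have hb : N.AsBounded W := hbG.mono hWG
  have hW : N.IsL0ConvexlyCompact W := hG.of_subset hWG hc hconv
  have hΛ : Nonempty Λ := hF.stable_index.nonempty
  have hdir := hF.directed
  have hbF : ∀ α, N.AsBounded (F α) := fun α => hb.mono (hF.subset α)
  have hne : ∀ α, (F α).Nonempty := fun α => (hF.sigmaStable α).1
  set r := N.rad W W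
  constructor
  · obtain ⟨α⟩ := hΛ
    obtain ⟨x, hx⟩ := hW.center_nonempty hE (hbF α) (hne α)
    exact ⟨x, N.subset_cl _ (mem_iUnion.2 ⟨α, hx⟩)⟩
  intro B₀ hB₀ hdiam hB₀pos
  by_contra! hcon
  have hrpos : ∀ᵐ ω ∂P, ω ∈ B₀ → 0 < r ω := by
    -- The diameter is at most twice any radius, so r is positive wherever D(W) is.
    have h1 : constHom P (1 / 2) * N.diam W ≤ r := by
      refine (hb.isGLB_rad hconv.1 hconv.1).2 ?_
      rintro _ ⟨z, hz, rfl⟩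
      have h2 := hb.diam_le hconv.1 (ρ := constHom P 2 * N.radAt W z) fun x hx y hy => by
        filter_upwards [hb.le_radAt z hx, hb.le_radAt z hy, N.ae_sub_le x z y,
          coeFn_mulL0 (constHom P 2) (N.radAt W z), coeFn_constHom (P := P) 2] with ω a1 a2 a3 a4 a5
        rw [N.sub_comm x z] at a3
        rw [a4, a5]; linarith
      rw [← AEEqFun.coeFn_le]
      filter_upwards [h2, coeFn_mulL0 (constHom P 2) (N.radAt W z), coeFn_constHom (P := P) 2,
        coeFn_mulL0 (constHom P (1 / 2)) (N.diam W), coeFn_constHom (P := P) (1 / 2)]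
        with ω a1 a2 a3 a4 a5
      rw [a2, a3] at a1
      rw [a4, a5]; linarith
    filter_upwards [AEEqFun.coeFn_le.2 h1, coeFn_mulL0 (constHom P (1 / 2)) (N.diam W),
      coeFn_constHom (P := P) (1 / 2), hdiam] with ω a1 a2 a3 a4 hω
    rw [a2, a3] at a1
    linarith [a4 hω]
  -- A constant lower bound for r is needed for the constant errors ε to be absorbed by multiples of
  -- r.
  obtain ⟨k, hk⟩ : ∃ k : ℕ, 0 < P (B₀ ∩ {ω | 1 / ((k : ℝ) + 1) ≤ r ω}) := by
    by_contra! h0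
    refine hB₀pos.ne' (measure_eq_zero_iff_ae_notMem.2 ?_)
    filter_upwards [hrpos, ae_all_iff.2 fun k =>
      measure_eq_zero_iff_ae_notMem.1 (nonpos_iff_eq_zero.1 (h0 k))] with ω a1 a2 hω
    obtain ⟨k, hk⟩ := exists_nat_one_div_lt (a1 hω)
    exact a2 k ⟨hω, hk.le⟩
  set c : ℝ := 1 / ((k : ℝ) + 1)
  have hcpos : 0 < c := by positivity
  let B : Set Ω := B₀ ∩ {ω | c ≤ r ω}
  have hB : MeasurableSet B := hB₀.inter (measurableSet_le measurable_const r.measurable)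
  have hrc : ∀ᵐ ω ∂P, ω ∈ B → c ≤ r ω := ae_of_all _ fun ω hω => hω.2
  -- On `B₀` the point x is a limit of centers `y n` with R(F(α_n), y_n) = r, so the Lipschitz
  -- property bounds every lower bound of the radii by r.
  have hnear : ∀ x ∈ W, ∀ ε : ℝ, 0 < ε → ∃ α, ∀ᵐ ω ∂P, ω ∈ B → N.radAt (F α) x ω ≤ r ω + ε := by
    intro x hx ε hε
    refine hF.exists_radAt_le hb x (fun s hs => ?_) hε
    obtain ⟨z, hz, hzx⟩ := hcon x hx
    obtain ⟨y, hy, hzy⟩ := N.mem_cl_iff_seq.1 hz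
    choose α hα using fun n => mem_iUnion.1 (hy n)
    filter_upwards [(N.ind_smul_eq_iff hB₀ z x).1 hzx, hzy, ae_all_iff.2 fun n => hs (α n),
      ae_all_iff.2 fun n => (hbF (α n)).radAt_le_add (hne (α n)) x (y n),
      ae_all_iff.2 fun n => N.ae_sub_le x z (y n)] with ω a1 a2 a3 a4 a5 hω
    have h1 : Tendsto (fun n => r ω + N (z - y n) ω) atTop (𝓝 (r ω + 0)) := a2.const_add _
    rw [add_zero] at h1
    refine ge_of_tendsto' h1 fun n => ?_
    have b1 := a5 n
    have b2 := a4 n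
    rw [N.sub_comm x z, a1 hω.1, zero_add] at b1
    rw [(hα n).2, hrad] at b2
    linarith [a3 n]
  -- The sets `F α` need not be closed or convex, so their closed convex supersets are intersected.
  -- Directedness gives the finite intersection property.
  obtain ⟨w, hw⟩ := hG.inter_nonempty {C | C ⊆ W ∧ N.Closed C ∧ IsL0Convex P 𝕜 C ∧ ∃ α, F α ⊆ C}
    (fun C hC => ⟨hC.1.trans hWG, hC.2.1, hC.2.2.1⟩) (by
      intro 𝒟 h𝒟 hfin
      have : ∀ D : Set E, ∃ α : Λ, D ∈ 𝒟 → F α ⊆ D := by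
        intro D
        by_cases hD : D ∈ 𝒟
        · obtain ⟨α, hα⟩ := (h𝒟 hD).2.2.2; exact ⟨α, fun _ => hα⟩
        · exact ⟨Classical.arbitrary Λ, fun h' => absurd h' hD⟩
      choose α hα using this
      classical
      obtain ⟨β, hβ⟩ := (hfin.toFinset.image α).exists_le
      obtain ⟨x, hx⟩ := hne β
      refine ⟨x, fun D hD => hα D hD (hF.decreasing (hβ _ ?_) hx)⟩
      exact Finset.mem_image_of_mem α (hfin.mem_toFinset.2 hD))
  have hwW : w ∈ W :=
    hw W ⟨subset_rfl, hc, hconv, Classical.arbitrary Λ, hF.subset _⟩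
  have hwr : ∀ x ∈ W, ∀ᵐ ω ∂P, ω ∈ B → N (x - w) ω ≤ r ω := by
    intro x hx
    have hε : ∀ n : ℕ, ∀ᵐ ω ∂P, ω ∈ B → N (x - w) ω ≤ r ω + 1 / ((n : ℝ) + 1) := by
      intro n
      obtain ⟨α, hα⟩ := hnear x hx (1 / ((n : ℝ) + 1)) (by positivity)
      -- The ball about x of radius r + 1/(n + 1) on B is one of the intersected sets, hence
      -- contains w.
      have hsub : F α ⊆ {z ∈ W | ∀ y ∈ ({x} : Set E), ∀ᵐ ω ∂P, ω ∈ B →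
          N (z - y) ω ≤ r ω + 1 / ((n : ℝ) + 1)} := by
        refine fun z hz => ⟨hF.subset α hz, ?_⟩
        rintro _ rfl
        filter_upwards [hα, (hbF α).le_radAt _ hz] with ω a1 a2 hω
        rw [N.sub_comm]
        exact a2.trans (a1 hω)
      have := (hw _ ⟨fun z hz => hz.1, hc.inter_ball _ _ _,
        hconv.inter_ball N _ _ _ ((hne α).mono hsub), α, hsub⟩).2 x rfl
      rwa [N.sub_comm] at this
    filter_upwards [ae_all_iff.2 hε] with ω a1 hω
    refine le_of_forall_pos_le_add fun ε hε => ?_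
    obtain ⟨n, hn⟩ := exists_nat_one_div_lt hε
    linarith [a1 n hω]
  obtain ⟨y, hy, hpair, hmean⟩ := hconv.exists_nearly_diametral_seq hcpos hrc hwW hwr (by
    intro Z hZ m hm ε hε
    have : ∀ z : E, ∃ α : Λ, z ∈ Z → ∀ᵐ ω ∂P, ω ∈ B → N.radAt (F α) z ω ≤ r ω + ε := by
      intro z
      by_cases hz : z ∈ Z
      · obtain ⟨α, hα⟩ := hnear z (hZ z hz) ε hε; exact ⟨α, fun _ => hα⟩
      · exact ⟨Classical.arbitrary Λ, fun h' => absurd h' hz⟩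
    choose α hα using this
    classical
    obtain ⟨β, hβ⟩ := (Z.image α).exists_le
    -- R(F β, m) ≥ R(F β, W) = r, so a nearly farthest point of `F β` is far from m; membership in
    -- every `F (α z)` keeps it close to Z.
    obtain ⟨u, hu, hum⟩ := (hbF β).exists_le_norm_sub (hF.sigmaStable β) m hε
    refine ⟨u, hF.subset β hu, fun z hz => ?_, ?_⟩
    · have hle := hF.decreasing (hβ _ (Finset.mem_image_of_mem α hz))
      filter_upwards [hα z hz, (hbF (α z)).le_radAt z (hle hu)] with ω a1 a2 hω
      exact a2.trans (a1 hω)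
    · filter_upwards [hum, (hbF β).rad_le (hne β) hm] with ω a1 a2 _
      rw [hrad] at a2
      linarith)
  obtain ⟨H, hHW, hHc, hHconv, hHd, hHr⟩ := hb.exists_diametral hc hconv hB
    (hrc.mono fun ω h hω => hcpos.le.trans (h hω)) hy hpair hmean
  have hbH : N.AsBounded H := hb.mono hHW
  have hpos : ∀ᵐ ω ∂P, ω ∈ B → 0 < N.diam H ω := by
    obtain ⟨z, hz⟩ := hHconv.1
    filter_upwards [hHr z hz, hbH.radAt_le_diam hz] with ω a1 a2 hω
    exact hcpos.trans_le (hω.2.trans ((a1 hω).trans a2))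
  have hDH : 0 < N.diam H := by
    refine lt_of_le_of_ne (nonneg_of_ae (hbH.diam_nonneg hHconv.1)) fun h0 => hk.ne' ?_
    refine measure_eq_zero_iff_ae_notMem.2 ?_
    filter_upwards [hpos, coeFn_zeroL0 (P := P) (R := ℝ)] with ω a1 a2 hω
    have := a1 hω
    rw [← h0, a2] at this
    exact lt_irrefl _ this
  obtain ⟨z, hz, hzd⟩ := h.exists_nondiametral H (hHW.trans hWG) hbH hHc hHconv hDH
  refine hk.ne' (measure_eq_zero_iff_ae_notMem.2 ?_)
  filter_upwards [hzd, hpos, hHd, hHr z hz] with ω a1 a2 a3 a4 hω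
  exact absurd ((a1 (a2 hω)).trans_le (a3 hω)) (not_lt.2 (a4 hω))

end NormalToComplete

end RandomNormed

end

theorem theorem1p14 {Ω : Type*} [MeasurableSpace Ω] (P : Measure Ω)
    [IsProbabilityMeasure P] (𝕜 : Type*) [RCLike 𝕜] (E : Type*) [AddCommGroup E]
    [Module (Ω →ₘ[P] 𝕜) E] (N : RandomNormed.L0Norm P 𝕜 E) (hE : N.IsComplete)
    (G : Set E) (hG : N.IsL0ConvexlyCompact G) :
    RandomNormed.L0Norm.HasRandomCompleteNormalStructure.{v} N G ↔
      N.HasRandomNormalStructure G :=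
  ⟨fun h => h.hasRandomNormalStructure hE, fun h => hG.hasRandomCompleteNormalStructure hE h⟩
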